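/- Let $d,n\ge 1$ be integers and $\alpha\in(1,2]$. For a real symmetric matrix $A=V\operatorname{diag}(\lambda_1,\dots,\lambda_d)V^T$ ($V$ orthogonal) and $f:\mathbb R\to\mathbb R$ put $f(A)=V\operatorname{diag}(f(\lambda_1),\dots,f(\lambda_d))V^T$; in particular $|A|^\alpha$ is defined with $f(x)=|x|^\alpha$. Let $\|\cdot\|_2$ denote the spectral norm of matrices. Let $X$ be a random vector in $\mathbb R^d$ with $\mathbb E X=0$ and $\|\mathbb E|XX^T|^\alpha\|_2<\infty$ (that is, all entries of $|XX^T|^\alpha$ are integrable). Put $$\Sigma=\mathbb E[XX^T],\qquad v^\alpha:=\big\|\mathbb E|XX^T|^\alpha\big\|_2,\qquad \bar d_\alpha:=\frac{\operatorname{tr}\big(\mathbb E|XX^T|^\alpha\big)}{\big\|\mathbb E|XX^T|^\alpha\big\|_2}$$ (with $\bar d_\alpha:=0$ if $X=0$ almost surely), and $$c_\alpha:=\max\Big(\frac{\alpha-1}{\alpha},\sqrt{\frac{2-\alpha}{\alpha}}\Big).$$ Let $\psi_\alpha:\mathbb R\to\mathbb R$ be any nondecreasing function such that for all $x\in\mathbb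 R$ $$-\log\big(1-x+c_\alpha|x|^\alpha\big)\le\psi_\alpha(x)\le\log\big(1+x+c_\alpha|x|^\alpha\big).$$ Let $X_1,\dots,X_n$ be i.i.d. copies of $X$, and for $\theta>0$ let $$\widehat\Sigma_n(\alpha,\theta):=\frac1{n\theta}\sum_{i=1}^n\psi_\alpha\big(\theta X_iX_i^T\big).$$ Then for all $\theta>0$ and $t>0$, $$\operatorname P\Big(\big\|\widehat\Sigma_n(\alpha,\theta)-\Sigma\big\|_2\ge t\Big)\le 2\,\bar d_\alpha\,e^{-\theta nt}\Big(e^{c_\alpha n\theta^\alpha v^\alpha}+c_\alpha n\theta^\alpha v^\alpha\Big)\Big(1+\frac{2}{\theta nt}+\frac{2}{(\theta nt)^2}\Big).$$ -/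

import Mathlib

open MeasureTheory ProbabilityTheory

noncomputable section

namespace ShrinkageCov

/-- The spectral norm `‖A‖₂`: the operator norm of `A` for the Euclidean norm. -/
def specNorm {d : ℕ} (A : Matrix (Fin d) (Fin d) ℝ) : ℝ :=
  ‖Matrix.toEuclideanCLM (n := Fin d) (𝕜 := ℝ) A‖

/-- The rank-one matrix `x xᵀ`. -/
def outer {d : ℕ} (x : EuclideanSpace ℝ (Fin d)) : Matrix (Fin d) (Fin d) ℝ :=
  Matrix.of fun i j => x i * x j

/-- `f(A) = V f(Λ) Vᵀ` for a symmetric matrix `A = V Λ Vᵀ`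
(see `Matrix.IsHermitian.cfc_eq`; every `f` is allowed, since the spectrum is finite). -/
def matFun {d : ℕ} (f : ℝ → ℝ) (A : Matrix (Fin d) (Fin d) ℝ) : Matrix (Fin d) (Fin d) ℝ :=
  cfc f A

/-- `|x xᵀ|^α`. -/
def absPow {d : ℕ} (α : ℝ) (x : EuclideanSpace ℝ (Fin d)) : Matrix (Fin d) (Fin d) ℝ :=
  matFun (fun u => |u| ^ α) (outer x)

/-- The entrywise expectation of a random matrix. -/
def expMat {Ω : Type*} [MeasurableSpace Ω] (P : Measure Ω) {d : ℕ}
    (A : Ω → Matrix (Fin d) (Fin d) ℝ) : Matrix (Fin d) (Fin d) ℝ :=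
  Matrix.of fun i j => ∫ ω, A ω i j ∂P

/-- `E |X Xᵀ|^α` is finite: each entry of `|X Xᵀ|^α` is integrable. -/
def FiniteMoment {Ω : Type*} [MeasurableSpace Ω] (P : Measure Ω) {d : ℕ} (α : ℝ)
    (X : Ω → EuclideanSpace ℝ (Fin d)) : Prop :=
  ∀ i j, Integrable (fun ω => absPow α (X ω) i j) P

/-- The number `v^α = ‖E |X Xᵀ|^α‖₂` (the `α`-th power is part of the name). -/
def vPow {Ω : Type*} [MeasurableSpace Ω] (P : Measure Ω) {d : ℕ} (α : ℝ)
    (X : Ω → EuclideanSpace ℝ (Fin d)) : ℝ :=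
  specNorm (expMat P fun ω => absPow α (X ω))

/-- The effective dimension `tr(E |X Xᵀ|^α) / ‖E |X Xᵀ|^α‖₂`; it is `0` if `X = 0` almost surely. -/
def effDim {Ω : Type*} [MeasurableSpace Ω] (P : Measure Ω) {d : ℕ} (α : ℝ)
    (X : Ω → EuclideanSpace ℝ (Fin d)) : ℝ :=
  (expMat P fun ω => absPow α (X ω)).trace / specNorm (expMat P fun ω => absPow α (X ω))

/-- `c_α = max ((α - 1) / α) (√((2 - α) / α))`. -/
def cAlpha (α : ℝ) : ℝ := max ((α - 1) / α) (Real.sqrt ((2 - α) / α))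

/-- The admissible functions `ψ_α`. For `1 < α ≤ 2` both logarithms have positive arguments. -/
structure IsPsi (α : ℝ) (ψ : ℝ → ℝ) : Prop where
  mono : Monotone ψ
  lower : ∀ x, -Real.log (1 - x + cAlpha α * |x| ^ α) ≤ ψ x
  upper : ∀ x, ψ x ≤ Real.log (1 + x + cAlpha α * |x| ^ α)

/-- The shrinkage covariance estimator `(1 / (nθ)) ∑ᵢ ψ(θ xᵢ xᵢᵀ)` of a sample `x₁, …, xₙ`. -/
def estimator {d n : ℕ} (ψ : ℝ → ℝ) (θ : ℝ) (x : Fin n → EuclideanSpace ℝ (Fin d)) :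
    Matrix (Fin d) (Fin d) ℝ :=
  (1 / ((n : ℝ) * θ)) • ∑ i, matFun ψ (θ • outer (x i))

end ShrinkageCov

end

open scoped Matrix
open Matrix (diagonal trace)

namespace ShrinkageCov

/-! The argument is a matrix Laplace transform. Let `D = nθ (Σ̂ - Σ)` be the normalized deviation
and `s = θnt`. On the event in question `‖D‖₂ ≥ s`, so one eigenvalue alone forces `tr exp D + tr
exp (-D) - 2d ≥ exp s - s - 1` (`le_trace_exp_add_trace_exp_neg`). This trace is nonnegative, so
Markov's inequality reduces everything to bounding its mean.

The conditions on `ψ` give, since each summand has rank one, the operator inequality `exp (±ψ(θxxᵀ))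
≤ 1 ± θxxᵀ + c_α θ^α |xxᵀ|^α` (`posSemidef_one_add_sub_exp`). Lieb's concavity theorem then replaces
the independent summands in the exponent by their mean bounds one at a time
(`lintegral_trace_exp_sum_le`). The linear parts cancel against the centring `∓nθΣ`, leaving `tr exp
(κM)` with `M = E|XXᵀ|^α` and `κ = c_α n θ^α`. Because `d` has been subtracted, convexity of `exp`
along the spectrum of `M` yields the effective dimension instead of `d` (`trace_exp_smul_sub_le`).
Finally `exp s - s - 1` is inverted by `one_le_exp_sub_mul`.

Lieb's theorem is obtained as the existence of a supporting functional (`exists_lieb_support`). The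
scalar relative entropy is an integral over `t ∈ [0, 1]` of terms `t (x - y)² / ((1 - t)x + ty)`,
each a supremum of functions linear in `(x, y)`. Written in the eigenbases of two matrices, this
makes the matrix relative entropy a maximum of linear functionals, that is, jointly convex with
explicit supports. The Gibbs variational principle converts such a support into one for `A ↦ tr exp
(H + log A)`. -/

theorem transpose_eq_of_isHermitian {n : Type*} {A : Matrix n n ℝ} (hA : A.IsHermitian) :
    Aᵀ = A := by
  rw [← Matrix.conjTranspose_eq_transpose_of_trivial]; exact hA

theorem isHermitian_smul {n : Type*} (c : ℝ) {A : Matrix n n ℝ} (hA : A.IsHermitian) :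
    (c • A).IsHermitian := by
  rw [Matrix.IsHermitian, Matrix.conjTranspose_smul, hA, star_trivial]

/-! ### Spectral decompositions and traces in a pair of eigenbases. -/

section Trace

variable {n : Type*} [Fintype n] [DecidableEq n]

theorem exists_orthogonal_diagonal {A : Matrix n n ℝ} (hA : A.IsHermitian) :
    ∃ (U : Matrix n n ℝ) (a : n → ℝ), Uᵀ * U = 1 ∧ U * Uᵀ = 1 ∧ A = U * diagonal a * Uᵀ := by
  refine ⟨hA.eigenvectorUnitary, hA.eigenvalues, ?_, ?_, ?_⟩
  · have := Unitary.coe_star_mul_self hA.eigenvectorUnitary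
    rwa [Matrix.star_eq_conjTranspose, Matrix.conjTranspose_eq_transpose_of_trivial] at this
  · have := Unitary.coe_mul_star_self hA.eigenvectorUnitary
    rwa [Unitary.coe_star, Matrix.star_eq_conjTranspose, Matrix.conjTranspose_eq_transpose_of_trivial] at this
  · have := hA.spectral_theorem
    rw [Unitary.conjStarAlgAut_apply, Matrix.star_eq_conjTranspose,
      Matrix.conjTranspose_eq_transpose_of_trivial] at this
    exact this

theorem isHermitian_conj_diagonal (U : Matrix n n ℝ) (a : n → ℝ) :
    (U * diagonal a * Uᵀ).IsHermitian := by
  rw [Matrix.IsHermitian, Matrix.conjTranspose_eq_transpose_of_trivial]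
  simp [Matrix.mul_assoc]

theorem posSemidef_conj_diagonal (U : Matrix n n ℝ) {a : n → ℝ} (ha : ∀ i, 0 ≤ a i) :
    (U * diagonal a * Uᵀ).PosSemidef := by
  have := (Matrix.PosSemidef.diagonal (R := ℝ) (d := a) ha).mul_mul_conjTranspose_same U
  rwa [Matrix.conjTranspose_eq_transpose_of_trivial] at this

theorem neg_conj_diagonal (U : Matrix n n ℝ) (a : n → ℝ) :
    -(U * diagonal a * Uᵀ) = U * diagonal (fun i => - a i) * Uᵀ := by
  have : diagonal (fun i => - a i) = - diagonal a := (Matrix.diagonal_neg a).symm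
  rw [this, Matrix.mul_neg, Matrix.neg_mul]

theorem smul_conj_diagonal (c : ℝ) (U : Matrix n n ℝ) (a : n → ℝ) :
    c • (U * diagonal a * Uᵀ) = U * diagonal (fun i => c * a i) * Uᵀ := by
  have : diagonal (fun i => c * a i) = c • diagonal a := Matrix.diagonal_smul c a
  rw [this, Matrix.mul_smul, Matrix.smul_mul]

theorem conj_conj_diagonal {U : Matrix n n ℝ} (hU : Uᵀ * U = 1) (a : n → ℝ) :
    Uᵀ * (U * diagonal a * Uᵀ) * U = diagonal a := by
  have : Uᵀ * (U * diagonal a * Uᵀ) * U = (Uᵀ * U) * diagonal a * (Uᵀ * U) := by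
    simp [Matrix.mul_assoc]
  rw [this, hU, Matrix.one_mul, Matrix.mul_one]

theorem trace_conj_diagonal {U : Matrix n n ℝ} (hU : Uᵀ * U = 1) (a : n → ℝ) :
    trace (U * diagonal a * Uᵀ) = ∑ i, a i := by
  rw [Matrix.trace_mul_comm, ← Matrix.mul_assoc, hU, Matrix.one_mul, Matrix.trace_diagonal]

theorem nonneg_of_posSemidef_conj_diagonal {U : Matrix n n ℝ} (hU : Uᵀ * U = 1) {a : n → ℝ}
    (h : (U * diagonal a * Uᵀ).PosSemidef) (i : n) : 0 ≤ a i := by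
  have hd := h.conjTranspose_mul_mul_same U
  rw [Matrix.conjTranspose_eq_transpose_of_trivial, conj_conj_diagonal hU] at hd
  simpa using hd.diag_nonneg (i := i)

theorem exp_conj_diagonal {U : Matrix n n ℝ} (hU : U * Uᵀ = 1) (a : n → ℝ) :
    NormedSpace.exp (U * diagonal a * Uᵀ) = U * diagonal (fun i => Real.exp (a i)) * Uᵀ := by
  have hinv : U⁻¹ = Uᵀ := Matrix.inv_eq_right_inv hU
  have hunit : IsUnit U := (Matrix.isUnit_iff_isUnit_det _).2 (Matrix.isUnit_det_of_right_inverse hU)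
  have := Matrix.exp_conj U (diagonal a) hunit
  rw [hinv] at this
  rw [this, Matrix.exp_diagonal]
  congr 3
  ext i
  rw [Pi.coe_exp, Real.exp_eq_exp_ℝ]

/-- The trace form computed in a pair of orthonormal bases. -/
theorem trace_transpose_mul_eq_sum {U V : Matrix n n ℝ} (hU : U * Uᵀ = 1) (hV : V * Vᵀ = 1)
    (P Q : Matrix n n ℝ) :
    trace (Pᵀ * Q) = ∑ j, ∑ k, (Vᵀ * P * U) j k * (Vᵀ * Q * U) j k := by
  have h : trace (Pᵀ * Q) = trace ((Vᵀ * P * U)ᵀ * (Vᵀ * Q * U)) := by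
    have e : (Vᵀ * P * U)ᵀ * (Vᵀ * Q * U) = Uᵀ * (Pᵀ * (V * Vᵀ) * Q * U) := by
      simp [Matrix.transpose_mul, Matrix.mul_assoc]
    rw [e, hV, Matrix.mul_one, Matrix.trace_mul_comm Uᵀ, Matrix.mul_assoc, hU, Matrix.mul_one]
  rw [h, Finset.sum_comm]
  generalize Vᵀ * P * U = P'
  generalize Vᵀ * Q * U = Q'
  simp [trace, Matrix.mul_apply]

theorem overlap_mul_conj_diagonal {U V : Matrix n n ℝ} (hU : Uᵀ * U = 1) (w : Matrix n n ℝ)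
    (x : n → ℝ) (j k : n) :
    (Vᵀ * (w * (U * diagonal x * Uᵀ)) * U) j k = (Vᵀ * w * U) j k * x k := by
  have : Vᵀ * (w * (U * diagonal x * Uᵀ)) * U = Vᵀ * w * U * diagonal x * (Uᵀ * U) := by
    simp [Matrix.mul_assoc]
  rw [this, hU, Matrix.mul_one, Matrix.mul_diagonal]

theorem overlap_conj_diagonal_mul {U V : Matrix n n ℝ} (hV : Vᵀ * V = 1) (w : Matrix n n ℝ)
    (y : n → ℝ) (j k : n) :
    (Vᵀ * ((V * diagonal y * Vᵀ) * w) * U) j k = y j * (Vᵀ * w * U) j k := by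
  have : Vᵀ * ((V * diagonal y * Vᵀ) * w) * U = (Vᵀ * V) * (diagonal y * (Vᵀ * w * U)) := by
    simp [Matrix.mul_assoc]
  rw [this, hV, Matrix.one_mul, Matrix.diagonal_mul]

/-- The squared overlaps of the two eigenbases serve as nonnegative weights, so trace inequalities
for two non-commuting matrices can be checked one pair of eigenvalues at a time. -/
theorem trace_conj_mul_conj {U V : Matrix n n ℝ} (hU : Uᵀ * U = 1) (hU' : U * Uᵀ = 1)
    (hV : Vᵀ * V = 1) (hV' : V * Vᵀ = 1) (x y : n → ℝ) :
    trace ((U * diagonal x * Uᵀ) * (V * diagonal y * Vᵀ))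
      = ∑ j, ∑ k, x k * y j * ((Vᵀ * U) j k) ^ 2 := by
  have h := trace_transpose_mul_eq_sum hU' hV' (U * diagonal x * Uᵀ) (V * diagonal y * Vᵀ)
  rw [transpose_eq_of_isHermitian (isHermitian_conj_diagonal U x)] at h
  rw [h]
  refine Finset.sum_congr rfl fun j _ => Finset.sum_congr rfl fun k _ => ?_
  have h1 := overlap_mul_conj_diagonal (V := V) hU 1 x j k
  have h2 := overlap_conj_diagonal_mul (U := U) hV 1 y j k
  rw [Matrix.one_mul, Matrix.mul_one] at h1
  rw [Matrix.mul_one, Matrix.mul_one] at h2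
  rw [h1, h2]; ring

theorem trace_conj_left {U V : Matrix n n ℝ} (hU : Uᵀ * U = 1) (hU' : U * Uᵀ = 1)
    (hV : Vᵀ * V = 1) (hV' : V * Vᵀ = 1) (x : n → ℝ) :
    trace (U * diagonal x * Uᵀ) = ∑ j, ∑ k, x k * ((Vᵀ * U) j k) ^ 2 := by
  have := trace_conj_mul_conj hU hU' hV hV' x (fun _ => 1)
  simpa [hV'] using this

theorem trace_conj_right {U V : Matrix n n ℝ} (hU : Uᵀ * U = 1) (hU' : U * Uᵀ = 1)
    (hV : Vᵀ * V = 1) (hV' : V * Vᵀ = 1) (y : n → ℝ) :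
    trace (V * diagonal y * Vᵀ) = ∑ j, ∑ k, y j * ((Vᵀ * U) j k) ^ 2 := by
  have := trace_conj_mul_conj hU hU' hV hV' (fun _ => 1) y
  simpa [hU'] using this

theorem conj_diagonal_mul_self {U : Matrix n n ℝ} (hU : Uᵀ * U = 1) (x y : n → ℝ) :
    (U * diagonal x * Uᵀ) * (U * diagonal y * Uᵀ) = U * diagonal (fun i => x i * y i) * Uᵀ := by
  have : (U * diagonal x * Uᵀ) * (U * diagonal y * Uᵀ)
      = U * diagonal x * (Uᵀ * U) * diagonal y * Uᵀ := by simp [Matrix.mul_assoc]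
  rw [this, hU, Matrix.mul_one, Matrix.mul_assoc U, Matrix.diagonal_mul_diagonal]

theorem trace_mul_nonneg {A B : Matrix n n ℝ} (hA : A.PosSemidef) (hB : B.PosSemidef) :
    0 ≤ trace (A * B) := by
  obtain ⟨U, a, hU, hU', rfl⟩ := exists_orthogonal_diagonal hA.1
  have h : trace (U * diagonal a * Uᵀ * B) = ∑ i, a i * (Uᵀ * B * U) i i := by
    rw [Matrix.mul_assoc, Matrix.mul_assoc, Matrix.trace_mul_comm, Matrix.mul_assoc]
    simp [trace, Matrix.diagonal_mul]
  have hBd : (Uᵀ * B * U).PosSemidef := by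
    have := hB.conjTranspose_mul_mul_same U
    rwa [Matrix.conjTranspose_eq_transpose_of_trivial] at this
  rw [h]
  refine Finset.sum_nonneg fun i _ => mul_nonneg
    (nonneg_of_posSemidef_conj_diagonal hU hA i) hBd.diag_nonneg

/-- Klein's inequality with a quadratic bound: the relative entropy of two positive definite
matrices is at most the `χ²`-divergence. -/
theorem trace_exp_mul_sub_le {P Q : Matrix n n ℝ} (hP : P.IsHermitian) (hQ : Q.IsHermitian) :
    trace (NormedSpace.exp P * (P - Q)) - trace (NormedSpace.exp P) + trace (NormedSpace.exp Q)
      ≤ trace (NormedSpace.exp P * NormedSpace.exp P * NormedSpace.exp (-Q))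
        - 2 * trace (NormedSpace.exp P) + trace (NormedSpace.exp Q) := by
  obtain ⟨U, p, hU, hU', rfl⟩ := exists_orthogonal_diagonal hP
  obtain ⟨V, q, hV, hV', rfl⟩ := exists_orthogonal_diagonal hQ
  rw [neg_conj_diagonal, exp_conj_diagonal hU', exp_conj_diagonal hV', exp_conj_diagonal hV',
    Matrix.mul_sub, Matrix.trace_sub, conj_diagonal_mul_self hU, conj_diagonal_mul_self hU,
    trace_conj_mul_conj hU hU' hV hV', trace_conj_mul_conj hU hU' hV hV',
    trace_conj_left hU hU' hV hV', trace_conj_left hU hU' hV hV']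
  -- Termwise this is `1 + u ≤ exp u` at `u = p k - q j`, multiplied by `exp (p k)` and the overlap
  -- weight.
  have key : ∑ j, ∑ k, (Real.exp (p k) * p k) * ((Vᵀ * U) j k) ^ 2
      - ∑ j, ∑ k, Real.exp (p k) * q j * ((Vᵀ * U) j k) ^ 2
      + ∑ j, ∑ k, Real.exp (p k) * ((Vᵀ * U) j k) ^ 2
      ≤ ∑ j, ∑ k, Real.exp (p k) * Real.exp (p k) * Real.exp (- q j) * ((Vᵀ * U) j k) ^ 2 := by
    simp only [← Finset.sum_sub_distrib, ← Finset.sum_add_distrib]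
    refine Finset.sum_le_sum fun j _ => Finset.sum_le_sum fun k _ => ?_
    have h1 : (p k - q j) + 1 ≤ Real.exp (p k) * Real.exp (- q j) := by
      rw [← Real.exp_add, ← sub_eq_add_neg]; exact Real.add_one_le_exp _
    have h2 := mul_le_mul_of_nonneg_left h1
      (mul_nonneg (Real.exp_pos (p k)).le (sq_nonneg ((Vᵀ * U) j k)))
    linarith
  linarith

end Trace

/-! ### Matrix relative entropy as a maximum of linear functionals. -/

section Entropy

theorem segment_pos {x y t : ℝ} (hx : 0 < x) (hy : 0 < y) (ht : t ∈ Set.Icc (0 : ℝ) 1) :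
    0 < (1 - t) * x + t * y := by
  rcases eq_or_lt_of_le ht.1 with h | h
  · rw [← h]; simpa using hx
  · have := mul_nonneg (sub_nonneg.2 ht.2) hx.le
    have := mul_pos h hy
    linarith

theorem continuousOn_entropy_kernel (h y : ℝ) :
    ContinuousOn (fun t : ℝ => t * ((Real.exp h - Real.exp y) ^ 2
      / ((1 - t) * Real.exp h + t * Real.exp y))) (Set.Icc 0 1) := by
  refine continuousOn_id.mul (ContinuousOn.div (by fun_prop) (by fun_prop) fun t ht => ?_)
  exact (segment_pos (Real.exp_pos h) (Real.exp_pos y) ht).ne'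

/-- The integral representation of the scalar relative entropy. -/
theorem integral_entropy_kernel (h y : ℝ) :
    ∫ t in (0 : ℝ)..1, t * ((Real.exp h - Real.exp y) ^ 2
      / ((1 - t) * Real.exp h + t * Real.exp y))
      = Real.exp h * (h - y) - Real.exp h + Real.exp y := by
  -- With `Δ = exp y - exp h` and `m = exp h + tΔ` one has `tΔ = m - exp h`, so the kernel `tΔ²/m`
  -- equals `Δ - exp h * Δ/m`, which integrates to this function.
  have hderiv : ∀ t ∈ Set.uIcc (0 : ℝ) 1, HasDerivAt (fun t : ℝ => (Real.exp y - Real.exp h) * t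
      - Real.exp h * Real.log ((1 - t) * Real.exp h + t * Real.exp y))
      (t * ((Real.exp h - Real.exp y) ^ 2 / ((1 - t) * Real.exp h + t * Real.exp y))) t := by
    intro t ht
    rw [Set.uIcc_of_le zero_le_one] at ht
    have hpos := segment_pos (Real.exp_pos h) (Real.exp_pos y) ht
    have h1 : HasDerivAt (fun t : ℝ => (1 - t) * Real.exp h + t * Real.exp y)
        ((0 - 1) * Real.exp h + 1 * Real.exp y) t :=
      (((hasDerivAt_const t (1 : ℝ)).sub (hasDerivAt_id t)).mul_const _).add
        ((hasDerivAt_id t).mul_const _)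
    have h2 := ((hasDerivAt_id t).const_mul (Real.exp y - Real.exp h)).sub
      ((h1.log hpos.ne').const_mul (Real.exp h))
    refine h2.congr_deriv ?_
    have hne := hpos.ne'
    rw [mul_one, ← mul_div_assoc, ← mul_div_assoc, sub_eq_iff_eq_add, ← add_div, eq_div_iff hne]
    ring
  rw [intervalIntegral.integral_eq_sub_of_hasDerivAt hderiv]
  · simp
    ring
  · refine ContinuousOn.intervalIntegrable ?_
    rw [Set.uIcc_of_le zero_le_one]
    exact continuousOn_entropy_kernel h y

variable {n : Type*} [Fintype n]

variable [DecidableEq n] in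
/-- The relative entropy of `exp P` with respect to `exp Y`. -/
noncomputable def relEntropy (P Y : Matrix n n ℝ) : ℝ :=
  trace (NormedSpace.exp P * (P - Y)) - trace (NormedSpace.exp P) + trace (NormedSpace.exp Y)

/-- The concave quadratic functional whose supremum over `w` is the integrand of the relative
entropy. -/
noncomputable def entropyDual (t : ℝ) (w T A : Matrix n n ℝ) : ℝ :=
  t * (2 * trace (wᵀ * (T - A)) - (1 - t) * trace ((w * T)ᵀ * w) - t * trace (wᵀ * (A * w)))

theorem continuousOn_entropyDual {w : ℝ → Matrix n n ℝ} (hw : ContinuousOn w (Set.Icc 0 1))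
    (T A : Matrix n n ℝ) :
    ContinuousOn (fun t => entropyDual t (w t) T A) (Set.Icc 0 1) := by
  have hq : Continuous fun M : Matrix n n ℝ => trace (Mᵀ * (T - A)) := by fun_prop
  have hq1 : Continuous fun M : Matrix n n ℝ => trace ((M * T)ᵀ * M) := by fun_prop
  have hq2 : Continuous fun M : Matrix n n ℝ => trace (Mᵀ * (A * M)) := by fun_prop
  unfold entropyDual
  have c1 := hq.comp_continuousOn hw
  have c2 := hq1.comp_continuousOn hw
  have c3 := hq2.comp_continuousOn hw
  exact continuousOn_id.mul (((continuousOn_const.mul c1).sub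
    ((continuousOn_const.sub continuousOn_id).mul c2)).sub (continuousOn_id.mul c3))

variable [DecidableEq n]

theorem relEntropy_conj_diagonal {U V : Matrix n n ℝ} (hU : Uᵀ * U = 1) (hU' : U * Uᵀ = 1)
    (hV : Vᵀ * V = 1) (hV' : V * Vᵀ = 1) (p y : n → ℝ) :
    relEntropy (U * diagonal p * Uᵀ) (V * diagonal y * Vᵀ)
      = ∑ j, ∑ k, ((Vᵀ * U) j k) ^ 2
          * (Real.exp (p k) * (p k - y j) - Real.exp (p k) + Real.exp (y j)) := by
  rw [relEntropy, exp_conj_diagonal hU', exp_conj_diagonal hV',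
    Matrix.mul_sub, Matrix.trace_sub, conj_diagonal_mul_self hU,
    trace_conj_mul_conj hU hU' hV hV', trace_conj_left hU hU' hV hV',
    trace_conj_left hU hU' hV hV', trace_conj_right hU hU' hV hV']
  simp only [← Finset.sum_sub_distrib, ← Finset.sum_add_distrib]
  exact Finset.sum_congr rfl fun j _ => Finset.sum_congr rfl fun k _ => by ring

/-- In the coordinates `Vᵀ w U` the quadratic form is diagonal: each entry has its own scalar
quadratic, so maximizing over matrices is maximizing entry by entry. -/
theorem entropyDual_conj_diagonal {U V : Matrix n n ℝ} (hU : Uᵀ * U = 1) (hU' : U * Uᵀ = 1)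
    (hV : Vᵀ * V = 1) (hV' : V * Vᵀ = 1) (t : ℝ) (w : Matrix n n ℝ) (x y : n → ℝ) :
    entropyDual t w (U * diagonal x * Uᵀ) (V * diagonal y * Vᵀ)
      = ∑ j, ∑ k, t * (2 * ((Vᵀ * w * U) j k * ((Vᵀ * U) j k * (x k - y j)))
          - ((1 - t) * x k + t * y j) * ((Vᵀ * w * U) j k) ^ 2) := by
  rw [entropyDual, trace_transpose_mul_eq_sum hU' hV', trace_transpose_mul_eq_sum hU' hV',
    trace_transpose_mul_eq_sum hU' hV']
  have h1 : ∀ j k, (Vᵀ * (U * diagonal x * Uᵀ - V * diagonal y * Vᵀ) * U) j k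
      = (Vᵀ * U) j k * (x k - y j) := by
    intro j k
    have h1 := overlap_mul_conj_diagonal (V := V) hU 1 x j k
    have h2 := overlap_conj_diagonal_mul (U := U) hV 1 y j k
    rw [Matrix.one_mul, Matrix.mul_one] at h1
    rw [Matrix.mul_one, Matrix.mul_one] at h2
    rw [Matrix.mul_sub, Matrix.sub_mul, Matrix.sub_apply, h1, h2]; ring
  simp only [h1, overlap_mul_conj_diagonal hU, overlap_conj_diagonal_mul hV, Finset.mul_sum,
    ← Finset.sum_sub_distrib]
  exact Finset.sum_congr rfl fun j _ => Finset.sum_congr rfl fun k _ => by ring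

theorem relEntropy_eq_integral {U V : Matrix n n ℝ} (hU : Uᵀ * U = 1) (hU' : U * Uᵀ = 1)
    (hV : Vᵀ * V = 1) (hV' : V * Vᵀ = 1) (p y : n → ℝ) :
    relEntropy (U * diagonal p * Uᵀ) (V * diagonal y * Vᵀ)
      = ∫ t in (0 : ℝ)..1, ∑ j, ∑ k, ((Vᵀ * U) j k) ^ 2 *
          (t * ((Real.exp (p k) - Real.exp (y j)) ^ 2
            / ((1 - t) * Real.exp (p k) + t * Real.exp (y j)))) := by
  have hint : ∀ j k, IntervalIntegrable (fun t : ℝ => ((Vᵀ * U) j k) ^ 2 *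
      (t * ((Real.exp (p k) - Real.exp (y j)) ^ 2
        / ((1 - t) * Real.exp (p k) + t * Real.exp (y j))))) volume 0 1 := by
    intro j k
    refine ContinuousOn.intervalIntegrable ?_
    rw [Set.uIcc_of_le zero_le_one]
    exact continuousOn_const.mul (continuousOn_entropy_kernel _ _)
  rw [relEntropy_conj_diagonal hU hU' hV hV', intervalIntegral.integral_finsetSum]
  · refine Finset.sum_congr rfl fun j _ => ?_
    rw [intervalIntegral.integral_finsetSum fun k _ => hint j k]
    refine Finset.sum_congr rfl fun k _ => ?_
    rw [intervalIntegral.integral_const_mul, integral_entropy_kernel]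
  · intro j _
    have := IntervalIntegrable.sum (μ := volume) (a := 0) (b := 1) Finset.univ
      (fun k _ => hint j k)
    refine this.congr ?_
    exact fun t _ => by simp only [Finset.sum_apply]

/-- Each continuous path `w` gives a lower bound on the relative entropy that is linear in the
two matrices. -/
theorem integral_entropyDual_le {P Y : Matrix n n ℝ} (hP : P.IsHermitian) (hY : Y.IsHermitian)
    {w : ℝ → Matrix n n ℝ} (hw : ContinuousOn w (Set.Icc 0 1)) :
    ∫ t in (0 : ℝ)..1, entropyDual t (w t) (NormedSpace.exp P) (NormedSpace.exp Y)
      ≤ relEntropy P Y := by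
  have hcont := continuousOn_entropyDual hw (NormedSpace.exp P) (NormedSpace.exp Y)
  obtain ⟨U, p, hU, hU', rfl⟩ := exists_orthogonal_diagonal hP
  obtain ⟨V, y, hV, hV', rfl⟩ := exists_orthogonal_diagonal hY
  rw [relEntropy_eq_integral hU hU' hV hV']
  refine intervalIntegral.integral_mono_on zero_le_one ?_ ?_ ?_
  · refine ContinuousOn.intervalIntegrable ?_
    rwa [Set.uIcc_of_le zero_le_one]
  · refine ContinuousOn.intervalIntegrable ?_
    rw [Set.uIcc_of_le zero_le_one]
    exact continuousOn_finsetSum _ fun j _ => continuousOn_finsetSum _ fun k _ =>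
      continuousOn_const.mul (continuousOn_entropy_kernel _ _)
  · intro t ht
    rw [exp_conj_diagonal hU', exp_conj_diagonal hV', entropyDual_conj_diagonal hU hU' hV hV']
    refine Finset.sum_le_sum fun j _ => Finset.sum_le_sum fun k _ => ?_
    have hM := segment_pos (Real.exp_pos (p k)) (Real.exp_pos (y j)) ht
    set M := (1 - t) * Real.exp (p k) + t * Real.exp (y j)
    set b := (Vᵀ * w t * U) j k
    set c := (Vᵀ * U) j k
    set e := Real.exp (p k) - Real.exp (y j)
    have key : 2 * (b * (c * e)) - M * b ^ 2 ≤ c ^ 2 * (e ^ 2 / M) := by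
      rw [← mul_div_assoc, le_div_iff₀ hM]
      nlinarith [sq_nonneg (c * e - M * b)]
    calc t * (2 * (b * (c * e)) - M * b ^ 2) ≤ t * (c ^ 2 * (e ^ 2 / M)) :=
          mul_le_mul_of_nonneg_left key ht.1
      _ = c ^ 2 * (t * (e ^ 2 / M)) := by ring

/-- The lower bound by `entropyDual` is attained. -/
theorem exists_integral_entropyDual_eq {P Y : Matrix n n ℝ} (hP : P.IsHermitian)
    (hY : Y.IsHermitian) :
    ∃ w : ℝ → Matrix n n ℝ, ContinuousOn w (Set.Icc 0 1) ∧
      ∫ t in (0 : ℝ)..1, entropyDual t (w t) (NormedSpace.exp P) (NormedSpace.exp Y)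
        = relEntropy P Y := by
  obtain ⟨U, p, hU, hU', rfl⟩ := exists_orthogonal_diagonal hP
  obtain ⟨V, y, hV, hV', rfl⟩ := exists_orthogonal_diagonal hY
  -- The maximizer `c e / M` of the quadratic `2 b c e - M b ^ 2` in each entry `b`; the path itself
  -- is `V m Uᵀ`.
  let m : ℝ → Matrix n n ℝ := fun t => Matrix.of fun j k =>
    (Vᵀ * U) j k * (Real.exp (p k) - Real.exp (y j))
      / ((1 - t) * Real.exp (p k) + t * Real.exp (y j))
  have hm : ContinuousOn m (Set.Icc 0 1) := by
    refine continuousOn_pi.2 fun j => continuousOn_pi.2 fun k => ?_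
    refine ContinuousOn.div (by fun_prop) (by fun_prop) fun t ht => ?_
    exact (segment_pos (Real.exp_pos _) (Real.exp_pos _) ht).ne'
  have hbasis : ∀ t, Vᵀ * (V * m t * Uᵀ) * U = m t := by
    intro t
    have : Vᵀ * (V * m t * Uᵀ) * U = (Vᵀ * V) * m t * (Uᵀ * U) := by simp [Matrix.mul_assoc]
    rw [this, hU, hV, Matrix.one_mul, Matrix.mul_one]
  have hcont : Continuous fun M : Matrix n n ℝ => V * M * Uᵀ := by fun_prop
  refine ⟨fun t => V * m t * Uᵀ, hcont.comp_continuousOn hm, ?_⟩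
  rw [relEntropy_eq_integral hU hU' hV hV']
  refine intervalIntegral.integral_congr fun t ht => ?_
  rw [Set.uIcc_of_le zero_le_one] at ht
  simp only
  rw [exp_conj_diagonal hU', exp_conj_diagonal hV', entropyDual_conj_diagonal hU hU' hV hV']
  refine Finset.sum_congr rfl fun j _ => Finset.sum_congr rfl fun k _ => ?_
  have hM := segment_pos (Real.exp_pos (p k)) (Real.exp_pos (y j)) ht
  rw [hbasis t]
  simp only [m, Matrix.of_apply]
  field_simp
  ring

end Entropy

/-! ### Lieb's concavity theorem through supporting functionals. -/

section Lieb

variable {n : Type*}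

/-- The entrywise integral of a matrix-valued path over `[0, 1]`. -/
noncomputable def pathIntegral (w : ℝ → Matrix n n ℝ) : Matrix n n ℝ :=
  Matrix.of fun i j => ∫ t in (0 : ℝ)..1, w t i j

theorem continuousOn_entry {w : ℝ → Matrix n n ℝ} (hw : ContinuousOn w (Set.Icc 0 1)) (i j : n) :
    ContinuousOn (fun t => w t i j) (Set.Icc 0 1) :=
  (by fun_prop : Continuous fun M : Matrix n n ℝ => M i j).comp_continuousOn hw

variable [Fintype n]

theorem trace_pathIntegral_mul {w : ℝ → Matrix n n ℝ} (hw : ContinuousOn w (Set.Icc 0 1))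
    (B : Matrix n n ℝ) :
    trace (pathIntegral w * B) = ∫ t in (0 : ℝ)..1, trace (w t * B) := by
  have hint : ∀ i j, IntervalIntegrable (fun t : ℝ => w t i j * B j i) volume 0 1 := by
    intro i j
    refine ContinuousOn.intervalIntegrable ?_
    rw [Set.uIcc_of_le zero_le_one]
    exact (continuousOn_entry hw i j).mul continuousOn_const
  simp only [trace, Matrix.diag, Matrix.mul_apply]
  rw [intervalIntegral.integral_finsetSum]
  · refine Finset.sum_congr rfl fun i _ => ?_
    rw [intervalIntegral.integral_finsetSum fun j _ => hint i j]
    exact Finset.sum_congr rfl fun j _ => (intervalIntegral.integral_mul_const _ _).symm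
  · intro i _
    have := IntervalIntegrable.sum (μ := volume) (a := 0) (b := 1) Finset.univ
      (fun j _ => hint i j)
    exact this.congr fun t _ => by simp only [Finset.sum_apply]

theorem posSemidef_pathIntegral {w : ℝ → Matrix n n ℝ} (hw : ContinuousOn w (Set.Icc 0 1))
    (h : ∀ t, (w t).PosSemidef) : (pathIntegral w).PosSemidef := by
  refine Matrix.PosSemidef.of_dotProduct_mulVec_nonneg ?_ fun x => ?_
  · ext i j
    have : ∀ t, w t j i = w t i j := fun t => by
      have := congrFun (congrFun (transpose_eq_of_isHermitian (h t).1) i) j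
      simpa using this
    simp [pathIntegral, this]
  · have e : ∀ M : Matrix n n ℝ, star x ⬝ᵥ M.mulVec x = trace (M * Matrix.vecMulVec x x) := by
      intro M
      rw [Matrix.mul_vecMulVec, Matrix.trace_vecMulVec, dotProduct_comm]
      simp
    rw [e, trace_pathIntegral_mul hw]
    refine intervalIntegral.integral_nonneg zero_le_one fun t _ => ?_
    rw [← e]
    exact (h t).dotProduct_mulVec_nonneg x

variable [DecidableEq n]

/-- Adding and subtracting `tr A` completes the coefficient of `A` to the square `(1 + tw)(1 +
tw)ᵀ`. This is the source of the positivity of `G`, and the `tr A` cancels the `tr exp Y` of the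
relative entropy. -/
theorem entropyDual_eq {T A : Matrix n n ℝ} (hT : T.IsHermitian) (hA : A.IsHermitian) (t : ℝ)
    (w : Matrix n n ℝ) :
    entropyDual t w T A
      = trace (((2 * t) • wᵀ - (t * (1 - t)) • (wᵀ * w)) * T)
        - trace (((1 + t • w) * (1 + t • w)ᵀ) * A) + trace A := by
  have hT' := transpose_eq_of_isHermitian hT
  have hA' := transpose_eq_of_isHermitian hA
  have h1 : trace ((w * T)ᵀ * w) = trace (wᵀ * w * T) := by
    rw [Matrix.transpose_mul, hT', Matrix.mul_assoc, Matrix.trace_mul_comm]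
  have h2 : trace (wᵀ * (A * w)) = trace (w * wᵀ * A) := by
    rw [← Matrix.mul_assoc, Matrix.trace_mul_comm, ← Matrix.mul_assoc]
  have h3 : trace (w * A) = trace (wᵀ * A) := by
    rw [← Matrix.trace_transpose, Matrix.transpose_mul, hA', Matrix.trace_mul_comm]
  rw [entropyDual, h1, h2]
  simp only [Matrix.transpose_add, Matrix.transpose_one, Matrix.transpose_smul, Matrix.add_mul,
    Matrix.mul_add, Matrix.one_mul, Matrix.mul_one, Matrix.smul_mul, Matrix.mul_smul,
    Matrix.sub_mul, Matrix.mul_sub, Matrix.trace_add, Matrix.trace_sub, Matrix.trace_smul,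
    smul_eq_mul, h3]
  ring

theorem integral_entropyDual_eq {w : ℝ → Matrix n n ℝ} (hw : ContinuousOn w (Set.Icc 0 1))
    {T A : Matrix n n ℝ} (hT : T.IsHermitian) (hA : A.IsHermitian) :
    ∫ t in (0 : ℝ)..1, entropyDual t (w t) T A
      = trace (pathIntegral (fun t => (2 * t) • (w t)ᵀ - (t * (1 - t)) • ((w t)ᵀ * w t)) * T)
        - trace (pathIntegral (fun t => (1 + t • w t) * (1 + t • w t)ᵀ) * A) + trace A := by
  have hid : ContinuousOn (fun t : ℝ => t) (Set.Icc 0 1) := continuousOn_id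
  have hwT : ContinuousOn (fun t => (w t)ᵀ) (Set.Icc 0 1) :=
    (by fun_prop : Continuous fun M : Matrix n n ℝ => Mᵀ).comp_continuousOn hw
  have hc1 : ContinuousOn
      (fun t => (2 * t) • (w t)ᵀ - (t * (1 - t)) • ((w t)ᵀ * w t)) (Set.Icc 0 1) := by
    refine ((continuousOn_const.mul hid).smul hwT).sub
      ((hid.mul (continuousOn_const.sub hid)).smul ?_)
    exact (by fun_prop : Continuous fun M : Matrix n n ℝ => Mᵀ * M).comp_continuousOn hw
  have hc2' : ContinuousOn (fun t => 1 + t • w t) (Set.Icc 0 1) :=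
    continuousOn_const.add (hid.smul hw)
  have hc2 : ContinuousOn (fun t => (1 + t • w t) * (1 + t • w t)ᵀ) (Set.Icc 0 1) :=
    (by fun_prop : Continuous fun M : Matrix n n ℝ => M * Mᵀ).comp_continuousOn hc2'
  have htr : ∀ B : Matrix n n ℝ, Continuous fun M : Matrix n n ℝ => trace (M * B) :=
    fun B => by fun_prop
  have ht1 : ContinuousOn (fun t => trace (((2 * t) • (w t)ᵀ - (t * (1 - t)) • ((w t)ᵀ * w t)) * T))
      (Set.Icc 0 1) := (htr T).comp_continuousOn hc1
  have ht2 : ContinuousOn (fun t => trace (((1 + t • w t) * (1 + t • w t)ᵀ) * A))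
      (Set.Icc 0 1) := (htr A).comp_continuousOn hc2
  rw [trace_pathIntegral_mul hc1, trace_pathIntegral_mul hc2]
  rw [← Set.uIcc_of_le (zero_le_one' ℝ)] at ht1 ht2
  rw [← intervalIntegral.integral_sub ht1.intervalIntegrable ht2.intervalIntegrable]
  have hconst : trace A = ∫ _ in (0 : ℝ)..1, trace A := by simp
  rw [hconst, ← intervalIntegral.integral_add
    (ht1.intervalIntegrable.sub ht2.intervalIntegrable) (by simp)]
  exact intervalIntegral.integral_congr fun t _ => entropyDual_eq hT hA t (w t)

/-- The path optimal at `(P₀, K)` is kept fixed: its functional is linear in the two exponentials,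
lies below the relative entropy everywhere and touches it at that pair. -/
theorem exists_supporting_pair {P₀ K : Matrix n n ℝ} (hP₀ : P₀.IsHermitian) (hK : K.IsHermitian) :
    ∃ Γ G : Matrix n n ℝ, G.PosSemidef ∧
      (∀ P Y : Matrix n n ℝ, P.IsHermitian → Y.IsHermitian →
        trace (Γ * NormedSpace.exp P) - trace (G * NormedSpace.exp Y)
          ≤ trace (NormedSpace.exp P * (P - Y)) - trace (NormedSpace.exp P)) ∧
      trace (Γ * NormedSpace.exp P₀) - trace (G * NormedSpace.exp K)
        = trace (NormedSpace.exp P₀ * (P₀ - K)) - trace (NormedSpace.exp P₀) := by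
  obtain ⟨w, hw, heq⟩ := exists_integral_entropyDual_eq hP₀ hK
  refine ⟨pathIntegral (fun t => (2 * t) • (w t)ᵀ - (t * (1 - t)) • ((w t)ᵀ * w t)),
    pathIntegral (fun t => (1 + t • w t) * (1 + t • w t)ᵀ), ?_, fun P Y hP hY => ?_, ?_⟩
  rotate_left
  · have h := integral_entropyDual_le hP hY hw
    rw [integral_entropyDual_eq hw hP.exp hY.exp, relEntropy] at h
    linarith
  · rw [integral_entropyDual_eq hw hP₀.exp hK.exp, relEntropy] at heq
    linarith
  · refine posSemidef_pathIntegral ?_ fun t => ?_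
    · have hc : ContinuousOn (fun t => 1 + t • w t) (Set.Icc 0 1) :=
        continuousOn_const.add (continuousOn_id.smul hw)
      exact (by fun_prop : Continuous fun M : Matrix n n ℝ => M * Mᵀ).comp_continuousOn hc
    · have := Matrix.posSemidef_self_mul_conjTranspose (1 + t • w t)
      rwa [Matrix.conjTranspose_eq_transpose_of_trivial] at this

theorem exists_exp_eq_of_posDef {T : Matrix n n ℝ} (hT : T.PosDef) :
    ∃ P : Matrix n n ℝ, P.IsHermitian ∧ NormedSpace.exp P = T := by
  obtain ⟨U, a, hU, hU', rfl⟩ := exists_orthogonal_diagonal hT.1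
  have ha : ∀ i, 0 < a i := by
    intro i
    have hinj : Function.Injective U.mulVec := by
      intro x y hxy
      have := congrArg (Uᵀ.mulVec) hxy
      simpa [Matrix.mulVec_mulVec, hU] using this
    have hd := hT.conjTranspose_mul_mul_same hinj
    rw [Matrix.conjTranspose_eq_transpose_of_trivial, conj_conj_diagonal hU] at hd
    simpa using hd.diag_pos (i := i)
  refine ⟨U * diagonal (fun i => Real.log (a i)) * Uᵀ, isHermitian_conj_diagonal _ _, ?_⟩
  rw [exp_conj_diagonal hU']
  simp [Real.exp_log (ha _)]

theorem exists_smul_one_sub_posSemidef {B : Matrix n n ℝ} (hB : B.IsHermitian) :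
    ∃ C : ℝ, 0 ≤ C ∧ (C • (1 : Matrix n n ℝ) - B).PosSemidef
      ∧ (C • (1 : Matrix n n ℝ) + B).PosSemidef := by
  obtain ⟨U, b, hU, hU', rfl⟩ := exists_orthogonal_diagonal hB
  have hb : ∀ i, |b i| ≤ ∑ j, |b j| := fun i =>
    Finset.single_le_sum (f := fun j => |b j|) (fun j _ => abs_nonneg _) (Finset.mem_univ i)
  have e : ∀ C : ℝ, C • (1 : Matrix n n ℝ) = U * diagonal (fun _ => C) * Uᵀ := by
    intro C
    rw [← Matrix.smul_one_eq_diagonal]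
    simp [hU']
  refine ⟨∑ j, |b j|, Finset.sum_nonneg fun _ _ => abs_nonneg _, ?_, ?_⟩
  · rw [e, ← Matrix.sub_mul, ← Matrix.mul_sub, Matrix.diagonal_sub]
    exact posSemidef_conj_diagonal U fun i => sub_nonneg.2 ((le_abs_self _).trans (hb i))
  · rw [e, ← Matrix.add_mul, ← Matrix.mul_add, Matrix.diagonal_add]
    refine posSemidef_conj_diagonal U fun i => ?_
    have := (neg_le_abs (b i)).trans (hb i)
    linarith

theorem exists_pos_smul_one_le_exp {P : Matrix n n ℝ} (hP : P.IsHermitian) :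
    ∃ m : ℝ, 0 < m ∧ (NormedSpace.exp P - m • (1 : Matrix n n ℝ)).PosSemidef := by
  obtain ⟨U, p, hU, hU', rfl⟩ := exists_orthogonal_diagonal hP
  have hp : ∀ i, |p i| ≤ ∑ j, |p j| := fun i =>
    Finset.single_le_sum (f := fun j => |p j|) (fun j _ => abs_nonneg _) (Finset.mem_univ i)
  refine ⟨Real.exp (-∑ j, |p j|), Real.exp_pos _, ?_⟩
  have e : ∀ C : ℝ, C • (1 : Matrix n n ℝ) = U * diagonal (fun _ => C) * Uᵀ := by
    intro C
    rw [← Matrix.smul_one_eq_diagonal]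
    simp [hU']
  rw [exp_conj_diagonal hU', e, ← Matrix.sub_mul, ← Matrix.mul_sub, Matrix.diagonal_sub]
  refine posSemidef_conj_diagonal U fun i => sub_nonneg.2 (Real.exp_le_exp.2 ?_)
  have := (neg_le_abs (p i)).trans (hp i)
  linarith

/-- Perturbations of either sign stay positive definite, hence are again exponentials of Hermitian
matrices; the first-order condition for `Γ` needs both signs. -/
theorem exists_posDef_exp_add_smul {P B : Matrix n n ℝ} (hP : P.IsHermitian)
    (hB : B.IsHermitian) :
    ∃ δ : ℝ, 0 < δ ∧ ∀ ε : ℝ, |ε| < δ → (NormedSpace.exp P + ε • B).PosDef := by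
  obtain ⟨m, hm, hPm⟩ := exists_pos_smul_one_le_exp hP
  obtain ⟨C, hC, hB1, hB2⟩ := exists_smul_one_sub_posSemidef hB
  refine ⟨m / (C + 1), by positivity, fun ε hε => ?_⟩
  have hlt : |ε| * C < m := by
    rw [lt_div_iff₀ (by positivity)] at hε
    nlinarith [abs_nonneg ε]
  have hone : ((m - |ε| * C) • (1 : Matrix n n ℝ)).PosDef :=
    Matrix.PosDef.one.smul (sub_pos.2 hlt)
  have hBε : (|ε| • C • (1 : Matrix n n ℝ) + ε • B).PosSemidef := by
    rcases abs_cases ε with ⟨h, _⟩ | ⟨h, h'⟩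
    · rw [h, ← smul_add]
      rw [← h]
      exact hB2.smul (abs_nonneg ε)
    · have : |ε| • C • (1 : Matrix n n ℝ) + ε • B = |ε| • (C • (1 : Matrix n n ℝ) - B) := by
        rw [h]; module
      rw [this]
      exact hB1.smul (abs_nonneg ε)
  have e : NormedSpace.exp P + ε • B = (m - |ε| * C) • (1 : Matrix n n ℝ)
      + ((NormedSpace.exp P - m • (1 : Matrix n n ℝ)) + (|ε| • C • (1 : Matrix n n ℝ) + ε • B)) := by
    module
  rw [e]
  exact hone.add_posSemidef (hPm.add hBε)

theorem eq_zero_of_forall_mul_le_sq {x C δ : ℝ} (hδ : 0 < δ)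
    (h : ∀ ε : ℝ, |ε| < δ → ε * x ≤ ε ^ 2 * C) : x = 0 := by
  by_contra hx
  have hC : 0 < |C| + 1 := by positivity
  have hx' : 0 < |x| := abs_pos.2 hx
  obtain ⟨r, hr0, hr⟩ : ∃ r : ℝ, 0 < r ∧ r < δ ∧ r * (|C| + 1) < |x| := by
    refine ⟨min (δ / 2) (|x| / (2 * (|C| + 1))), by positivity, ?_, ?_⟩
    · exact (min_le_left _ _).trans_lt (by linarith)
    · have := min_le_right (δ / 2) (|x| / (2 * (|C| + 1)))
      calc _ ≤ |x| / (2 * (|C| + 1)) * (|C| + 1) := by gcongr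
        _ = |x| / 2 := by field_simp
        _ < |x| := by linarith
  have key : r * |x| ≤ r ^ 2 * C := by
    rcases abs_cases x with ⟨hx1, _⟩ | ⟨hx1, _⟩
    · rw [hx1]; exact h r (by rw [abs_of_pos hr0]; exact hr.1)
    · have := h (-r) (by rw [abs_neg, abs_of_pos hr0]; exact hr.1)
      rw [hx1]; linarith
  have h1 : r ^ 2 * C ≤ r * (r * (|C| + 1)) := by
    have := le_abs_self C
    nlinarith [sq_nonneg r]
  have h2 := mul_lt_mul_of_pos_left hr.2 hr0
  linarith

/-- **Lieb's concavity theorem** in the form of a supporting functional: for Hermitian `H` the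
map `A ↦ tr exp (H + log A)` lies below a linear functional which it touches at `A = exp K`. -/
theorem exists_lieb_support {H K : Matrix n n ℝ} (hH : H.IsHermitian) (hK : K.IsHermitian) :
    ∃ G : Matrix n n ℝ, G.PosSemidef ∧
      (∀ Y : Matrix n n ℝ, Y.IsHermitian →
        trace (NormedSpace.exp (H + Y)) ≤ trace (G * NormedSpace.exp Y)) ∧
      trace (G * NormedSpace.exp K) = trace (NormedSpace.exp (H + K)) := by
  have hP₀ := hH.add hK
  obtain ⟨Γ, G, hG, hle, heq⟩ := exists_supporting_pair hP₀ hK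
  -- First-order condition at `T = exp (H + K)`. Testing the support at `T + εB` bounds `ε (tr ΓB -
  -- tr BH)` by the relative entropy of `T + εB` with respect to `T`, which is at most `ε² tr (B B
  -- T⁻¹)` by `trace_exp_mul_sub_le`. Both signs of `ε` force equality.
  have hΓ : ∀ B : Matrix n n ℝ, B.IsHermitian → trace (Γ * B) = trace (B * H) := by
    intro B hB
    obtain ⟨δ, hδ, hpd⟩ := exists_posDef_exp_add_smul hP₀ hB
    refine sub_eq_zero.1 (eq_zero_of_forall_mul_le_sq (C := trace (B * B * NormedSpace.exp
      (-(H + K)))) hδ fun ε hε => ?_)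
    obtain ⟨P, hP, hPe⟩ := exists_exp_eq_of_posDef (hpd ε hε)
    have h1 := hle P K hP hK
    have h2 := trace_exp_mul_sub_le hP hP₀
    have hinv : NormedSpace.exp (H + K) * NormedSpace.exp (-(H + K)) = 1 := by
      rw [← Matrix.exp_add_of_commute _ _ ((Commute.refl (H + K)).neg_right), add_neg_cancel,
        NormedSpace.exp_zero]
    have hinv' : NormedSpace.exp (-(H + K)) * NormedSpace.exp (H + K) = 1 := by
      rw [← Matrix.exp_add_of_commute _ _ ((Commute.refl (H + K)).neg_left), neg_add_cancel,
        NormedSpace.exp_zero]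
    have hPK : P - K = (P - (H + K)) + H := by abel
    rw [hPK, Matrix.mul_add, Matrix.trace_add, hPe] at h1
    rw [add_sub_cancel_right] at heq
    rw [hPe] at h2
    generalize NormedSpace.exp (-(H + K)) = R at *
    generalize NormedSpace.exp (H + K) = T at *
    have e1 : trace (T * B * R) = trace B := by
      rw [Matrix.trace_mul_comm, ← Matrix.mul_assoc, hinv', Matrix.one_mul]
    simp only [Matrix.mul_add, Matrix.add_mul, Matrix.trace_add, Matrix.trace_smul,
      Matrix.mul_smul, Matrix.smul_mul, smul_eq_mul] at h1 h2
    rw [Matrix.mul_assoc T T R, Matrix.mul_assoc B T R, hinv, Matrix.mul_one, Matrix.mul_one,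
      e1] at h2
    nlinarith
  refine ⟨G, hG, fun Y hY => ?_, ?_⟩
  -- At `P = H + Y` the entropy term is `tr (exp P * H)`, which equals `tr (Γ * exp P)` and cancels.
  · have h := hle (H + Y) Y (hH.add hY) hY
    rw [hΓ _ (hH.add hY).exp, add_sub_cancel_right] at h
    linarith
  · rw [hΓ _ hP₀.exp, add_sub_cancel_right] at heq
    linarith

end Lieb

/-! ### Scalar inequalities for `c_α`, `ψ` and the exponential. -/

section Scalar

theorem cAlpha_pos {α : ℝ} (hα : 1 < α) : 0 < cAlpha α :=
  lt_max_of_lt_left (div_pos (by linarith) (by linarith))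

theorem half_rpow_lt_of_half_le_sq {b : ℝ} (hb : 0 < b) (h : 1 / 2 ≤ b ^ 2) :
    (1 / 2 : ℝ) ^ b < b := by
  have hb1 : (1 / 2 : ℝ) < b := by nlinarith
  have h1 : (1 / 2 : ℝ) ^ b < (1 / 2 : ℝ) ^ (1 / 2 : ℝ) :=
    Real.rpow_lt_rpow_of_exponent_gt (by norm_num) (by norm_num) hb1
  rw [← Real.sqrt_eq_rpow] at h1
  exact h1.trans_le (Real.sqrt_le_iff.2 ⟨hb.le, h⟩)

theorem half_rpow_lt_sqrt_of_sq_lt_half {b : ℝ} (hb : 0 < b) (h : b ^ 2 < 1 / 2) :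
    (1 / 2 : ℝ) ^ b < √(1 - b ^ 2) := by
  have hb1 : b < 1 := by nlinarith
  refine (Real.lt_sqrt (by positivity)).2 ?_
  -- Bernoulli's inequality for `(1 - 1/2) ^ p` with exponent `p = 2 b ^ 2 ≤ 1`.
  have hconv : (1 / 4 : ℝ) ^ (b ^ 2) ≤ 1 - b ^ 2 := by
    have := rpow_one_add_le_one_add_mul_self (s := -1 / 2) (by norm_num) (p := 2 * b ^ 2)
      (by positivity) (by linarith)
    have e : (1 / 4 : ℝ) ^ (b ^ 2) = (1 + -1 / 2 : ℝ) ^ (2 * b ^ 2) := by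
      rw [Real.rpow_mul (by norm_num)]; norm_num
    rw [e]; linarith
  have hlt : (1 / 4 : ℝ) ^ b < (1 / 4 : ℝ) ^ (b ^ 2) :=
    Real.rpow_lt_rpow_of_exponent_gt (by norm_num) (by norm_num) (by nlinarith)
  have e : ((1 / 2 : ℝ) ^ b) ^ 2 = (1 / 4 : ℝ) ^ b := by
    rw [← Real.rpow_natCast, ← Real.rpow_mul (by norm_num), mul_comm, Real.rpow_mul (by norm_num)]
    norm_num
  rw [e]; exact hlt.trans_le hconv

/-- With `b = α - 1`, `α c_α = max b √(1 - b²)`, and `α / (α - 1) = (b + 1)/b ≥ 2`; so it suffices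
that this maximum exceeds `2^(-b)`. The two entries cross at `b² = 1/2`, which is where the cases
split. -/
theorem one_lt_mul_cAlpha_mul_rpow {α : ℝ} (hα₁ : 1 < α) (hα₂ : α ≤ 2) :
    1 < α * cAlpha α * (α / (α - 1)) ^ (α - 1) := by
  obtain ⟨b, rfl⟩ : ∃ b, α = b + 1 := ⟨α - 1, by ring⟩
  have hb : 0 < b := by linarith
  have hb1 : b ≤ 1 := by linarith
  rw [add_sub_cancel_right]
  have hz : (2 : ℝ) ^ b ≤ ((b + 1) / b) ^ b := by
    refine Real.rpow_le_rpow (by norm_num) ?_ hb.le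
    rw [le_div_iff₀ hb]; linarith
  have hhalf : (1 / 2 : ℝ) ^ b < (b + 1) * cAlpha (b + 1) := by
    rcases le_or_gt (1 / 2) (b ^ 2) with h | h
    · refine (half_rpow_lt_of_half_le_sq hb h).trans_le ?_
      have := le_max_left ((b + 1 - 1) / (b + 1)) (√((2 - (b + 1)) / (b + 1)))
      rw [div_le_iff₀ (by linarith)] at this
      rw [cAlpha]; linarith
    · refine (half_rpow_lt_sqrt_of_sq_lt_half hb h).trans_le ?_
      have h1 := le_max_right ((b + 1 - 1) / (b + 1)) (√((2 - (b + 1)) / (b + 1)))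
      have e : √(1 - b ^ 2) = (b + 1) * √((2 - (b + 1)) / (b + 1)) := by
        have : (1 - b ^ 2) = (b + 1) ^ 2 * ((2 - (b + 1)) / (b + 1)) := by
          field_simp; ring
        rw [this, Real.sqrt_mul (by positivity), Real.sqrt_sq (by positivity)]
      rw [e, cAlpha]
      exact mul_le_mul_of_nonneg_left h1 (by linarith)
  have hprod : (1 / 2 : ℝ) ^ b * (2 : ℝ) ^ b = 1 := by
    rw [← Real.mul_rpow (by norm_num) (by norm_num)]; norm_num
  calc (1 : ℝ) = (1 / 2 : ℝ) ^ b * (2 : ℝ) ^ b := hprod.symm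
    _ < (b + 1) * cAlpha (b + 1) * (2 : ℝ) ^ b := by gcongr
    _ ≤ _ := mul_le_mul_of_nonneg_left hz
      (mul_nonneg (by linarith) (cAlpha_pos (by linarith)).le)

/-- Needed for `exp` to undo the logarithm in the lower bound on `ψ`. For `x > 1`, the tangent to
`x^α` at `z = α / (α - 1)` is the one through `(1, 0)`, so `x^α ≥ α z^(α - 1) (x - 1)`, and `c_α`
times this slope exceeds `1`. -/
theorem one_sub_add_cAlpha_pos {α : ℝ} (hα₁ : 1 < α) (hα₂ : α ≤ 2) {x : ℝ} (hx : 0 ≤ x) :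
    0 < 1 - x + cAlpha α * |x| ^ α := by
  have hc := cAlpha_pos hα₁
  rw [abs_of_nonneg hx]
  rcases le_or_gt x 1 with h1 | h1
  · rcases eq_or_lt_of_le hx with h0 | h0
    · rw [← h0, Real.zero_rpow (by linarith)]; simp
    · have := mul_pos hc (Real.rpow_pos_of_pos h0 α)
      linarith
  · have hα : 0 < α - 1 := by linarith
    set z := α / (α - 1)
    have hz : 0 < z := div_pos (by linarith) hα
    have hbern := one_add_mul_self_le_rpow_one_add (s := x / z - 1)
      (by linarith [div_nonneg hx hz.le]) hα₁.le
    rw [add_sub_cancel, Real.div_rpow hx hz.le, le_div_iff₀ (Real.rpow_pos_of_pos hz α)] at hbern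
    have e1 : z ^ α = z * z ^ (α - 1) := by
      rw [← Real.rpow_one_add' hz.le (by linarith)]; ring_nf
    have e2 : (1 + α * (x / z - 1)) * z ^ α = α * z ^ (α - 1) * (x - 1) := by
      rw [e1]; simp only [z]; field_simp; ring
    rw [e2] at hbern
    have hk := one_lt_mul_cAlpha_mul_rpow hα₁ hα₂
    have h3 := mul_lt_mul_of_pos_right hk (sub_pos.2 h1)
    have h4 := mul_le_mul_of_nonneg_left hbern hc.le
    nlinarith

theorem IsPsi.map_zero {α : ℝ} {ψ : ℝ → ℝ} (hψ : IsPsi α ψ) (hα : 1 < α) : ψ 0 = 0 := by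
  have h1 := hψ.lower 0
  have h2 := hψ.upper 0
  rw [abs_zero, Real.zero_rpow (by linarith)] at h1 h2
  simp at h1 h2
  linarith

theorem IsPsi.exp_le {α : ℝ} {ψ : ℝ → ℝ} (hψ : IsPsi α ψ) (hα : 1 < α) {x : ℝ} (hx : 0 ≤ x) :
    Real.exp (ψ x) ≤ 1 + x + cAlpha α * |x| ^ α := by
  have hc := cAlpha_pos hα
  have hpos : 0 < 1 + x + cAlpha α * |x| ^ α := by positivity
  calc _ ≤ _ := Real.exp_le_exp.2 (hψ.upper x)
    _ = _ := Real.exp_log hpos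

theorem IsPsi.exp_neg_le {α : ℝ} {ψ : ℝ → ℝ} (hψ : IsPsi α ψ) (hα₁ : 1 < α) (hα₂ : α ≤ 2) {x : ℝ}
    (hx : 0 ≤ x) : Real.exp (- ψ x) ≤ 1 - x + cAlpha α * |x| ^ α :=
  calc _ ≤ _ := Real.exp_le_exp.2 (neg_le.1 (hψ.lower x))
    _ = _ := Real.exp_log (one_sub_add_cAlpha_pos hα₁ hα₂ hx)

/-- After clearing denominators, a factor `s + 1` splits off and what remains is `1 + s + s²/2 ≤ exp
s`. -/
theorem one_le_exp_sub_mul {s : ℝ} (hs : 0 < s) :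
    1 ≤ (Real.exp s - s - 1) * (Real.exp (-s) * (1 + 2 / s + 2 / s ^ 2)) := by
  have h := Real.quadratic_le_exp_of_nonneg hs.le
  have he := Real.exp_pos s
  have e : (Real.exp s - s - 1) * (Real.exp (-s) * (1 + 2 / s + 2 / s ^ 2))
      = (Real.exp s - s - 1) * (s ^ 2 + 2 * s + 2) / (Real.exp s * s ^ 2) := by
    rw [Real.exp_neg]; field_simp
  rw [e, le_div_iff₀ (by positivity)]
  nlinarith

/-- By convexity, `exp` lies below its chord from `0` to `κv`. Applied to eigenvalues `m` with `v`
the spectral norm, it produces the ratio of trace to norm. -/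
theorem exp_mul_sub_one_le {κ m v : ℝ} (hm : 0 ≤ m) (hmv : m ≤ v) :
    Real.exp (κ * m) - 1 ≤ m / v * (Real.exp (κ * v) - 1) := by
  rcases eq_or_lt_of_le (hm.trans hmv) with h | hv
  · have : m = 0 := le_antisymm (h ▸ hmv) hm
    simp [this]
  · have hle : m / v ≤ 1 := (div_le_one hv).2 hmv
    have h := convexOn_exp.2 (Set.mem_univ (κ * v)) (Set.mem_univ 0) (div_nonneg hm hv.le)
      (sub_nonneg.2 hle) (by ring)
    have e : (m / v) • (κ * v) + (1 - m / v) • (0 : ℝ) = κ * m := by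
      simp only [smul_eq_mul]; field_simp; ring
    rw [e] at h
    simp only [smul_eq_mul, Real.exp_zero] at h
    linarith

end Scalar

/-! ### Functional calculus of rank-one matrices. -/

section RankOne

variable {d : ℕ}

theorem outer_mul_self (x : EuclideanSpace ℝ (Fin d)) :
    outer x * outer x = ‖x‖ ^ 2 • outer x := by
  ext i j
  rw [EuclideanSpace.real_norm_sq_eq]
  simp only [outer, Matrix.mul_apply, Matrix.of_apply, Matrix.smul_apply, smul_eq_mul,
    Finset.sum_mul]
  exact Finset.sum_congr rfl fun k _ => by ring

theorem isHermitian_outer (x : EuclideanSpace ℝ (Fin d)) : (outer x).IsHermitian := by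
  ext i j
  simp [outer, mul_comm]

theorem posSemidef_outer (x : EuclideanSpace ℝ (Fin d)) : (outer x).PosSemidef := by
  have := Matrix.posSemidef_vecMulVec_self_star (R := ℝ) (fun i => x i)
  have e : outer x = Matrix.vecMulVec (fun i => x i) (star fun i => x i) := by
    ext i j
    simp [outer, Matrix.vecMulVec_apply]
  rwa [e]

theorem outer_eq_zero_of_norm {x : EuclideanSpace ℝ (Fin d)} (hx : ‖x‖ ^ 2 = 0) : outer x = 0 := by
  have : x = 0 := by simpa using hx
  ext i j
  simp [this, outer]

theorem trace_outer (x : EuclideanSpace ℝ (Fin d)) : trace (outer x) = ‖x‖ ^ 2 := by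
  rw [EuclideanSpace.real_norm_sq_eq]
  simp only [trace, Matrix.diag, outer, Matrix.of_apply]
  exact Finset.sum_congr rfl fun k _ => by ring

/-- A function of a matrix whose eigenvalues lie in `{0, r}`. -/
theorem conj_diagonal_of_mul_self_eq {n : Type*} [Fintype n] [DecidableEq n] {A U : Matrix n n ℝ}
    {a : n → ℝ} {r : ℝ} (hU : Uᵀ * U = 1) (hA : A = U * diagonal a * Uᵀ) (hAA : A * A = r • A)
    {f : ℝ → ℝ} (hf : f 0 = 0) :
    U * diagonal (fun i => f (a i)) * Uᵀ = (f r / r) • A := by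
  have ha : ∀ i, a i * a i = r * a i := by
    rw [hA, smul_conj_diagonal, conj_diagonal_mul_self hU] at hAA
    have := congrArg (fun M => Uᵀ * M * U) hAA
    simp only [conj_conj_diagonal hU] at this
    exact fun i => congrFun (Matrix.diagonal_injective this) i
  have hfa : (fun i => f (a i)) = (f r / r) • a := by
    funext i
    rcases eq_or_ne (a i) 0 with h | h
    · simp [h, hf]
    · have : a i = r := mul_right_cancel₀ h (ha i)
      have hr : r ≠ 0 := this ▸ h
      rw [Pi.smul_apply, this, smul_eq_mul, div_mul_cancel₀ _ hr]
  rw [hfa, Matrix.diagonal_smul, hA, Matrix.mul_smul, Matrix.smul_mul]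

theorem smul_outer_mul_self (θ : ℝ) (x : EuclideanSpace ℝ (Fin d)) :
    (θ • outer x) * (θ • outer x) = (θ * ‖x‖ ^ 2) • (θ • outer x) := by
  rw [Matrix.smul_mul, Matrix.mul_smul, outer_mul_self, smul_smul, smul_smul, smul_smul]
  congr 1; ring

/-- The eigenvalues lie in `{0, θ‖x‖²}`, and a function vanishing at `0` is linear on that set. For
`x = 0` the division by zero is harmless, since `outer x = 0`. -/
theorem matFun_smul_outer {f : ℝ → ℝ} (hf : f 0 = 0) {θ : ℝ} (hθ : θ ≠ 0)
    (x : EuclideanSpace ℝ (Fin d)) :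
    matFun f (θ • outer x) = (f (θ * ‖x‖ ^ 2) / ‖x‖ ^ 2) • outer x := by
  have hA := isHermitian_smul θ (isHermitian_outer x)
  have hspec := hA.spectral_theorem
  have hU := Unitary.coe_star_mul_self hA.eigenvectorUnitary
  rw [matFun, hA.cfc_eq, Matrix.IsHermitian.cfc]
  rw [Unitary.conjStarAlgAut_apply, Matrix.star_eq_conjTranspose,
    Matrix.conjTranspose_eq_transpose_of_trivial] at hspec ⊢
  rw [Matrix.star_eq_conjTranspose, Matrix.conjTranspose_eq_transpose_of_trivial] at hU
  refine (conj_diagonal_of_mul_self_eq hU hspec (smul_outer_mul_self θ x) hf).trans ?_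
  rw [smul_smul]
  congr 1
  rcases eq_or_ne (‖x‖ ^ 2) 0 with h | h
  · simp [h]
  · field_simp

theorem absPow_eq {α : ℝ} (hα : 1 < α) (x : EuclideanSpace ℝ (Fin d)) :
    absPow α x = (|‖x‖ ^ 2| ^ α / ‖x‖ ^ 2) • outer x := by
  have := matFun_smul_outer (f := fun u => |u| ^ α) 
    (by simp only [abs_zero]; exact Real.zero_rpow (by linarith)) one_ne_zero x
  rwa [one_smul, one_mul] at this

/-- The same two-point spectrum argument for `exp y - 1`, which vanishes at `0`. -/
theorem exp_smul_outer (u : ℝ) (x : EuclideanSpace ℝ (Fin d)) :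
    NormedSpace.exp ((u / ‖x‖ ^ 2) • outer x)
      = 1 + ((Real.exp u - 1) / ‖x‖ ^ 2) • outer x := by
  rcases eq_or_ne (‖x‖ ^ 2) 0 with h0 | h0
  · rw [outer_eq_zero_of_norm h0]; simp [NormedSpace.exp_zero]
  have hA := isHermitian_smul (u / ‖x‖ ^ 2) (isHermitian_outer x)
  obtain ⟨U, a, hU, hU', ha⟩ := exists_orthogonal_diagonal hA
  have h := conj_diagonal_of_mul_self_eq hU ha (smul_outer_mul_self _ x)
    (f := fun y => Real.exp y - 1) (by simp)
  rw [div_mul_cancel₀ _ h0] at h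
  have hsub : U * diagonal (fun i => Real.exp (a i) - 1) * Uᵀ
      = U * diagonal (fun i => Real.exp (a i)) * Uᵀ - 1 := by
    rw [← Matrix.diagonal_sub, Matrix.mul_sub, Matrix.sub_mul, Matrix.diagonal_one,
      Matrix.mul_one, hU']
  rw [hsub, ← exp_conj_diagonal hU', ← ha, sub_eq_iff_eq_add, smul_smul] at h
  rw [h, add_comm]
  congr 2
  rcases eq_or_ne u 0 with hu | hu
  · simp [hu]
  · field_simp

/-- The operator inequality `exp Y ≤ 1 + W` for rank-one `Y`, from the scalar one. -/
theorem posSemidef_one_add_sub_exp {u : ℝ} {σ θ c α : ℝ} (hα : 1 < α) (hθ : 0 < θ)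
    (x : EuclideanSpace ℝ (Fin d))
    (hu : Real.exp u ≤ 1 + σ * (θ * ‖x‖ ^ 2) + c * |θ * ‖x‖ ^ 2| ^ α) :
    (1 + ((σ * θ) • outer x + (c * θ ^ α) • absPow α x)
      - NormedSpace.exp ((u / ‖x‖ ^ 2) • outer x)).PosSemidef := by
  rw [exp_smul_outer, absPow_eq hα]
  have e : 1 + ((σ * θ) • outer x + (c * θ ^ α) • (|‖x‖ ^ 2| ^ α / ‖x‖ ^ 2) • outer x)
      - (1 + ((Real.exp u - 1) / ‖x‖ ^ 2) • outer x)
      = (σ * θ + c * θ ^ α * (|‖x‖ ^ 2| ^ α / ‖x‖ ^ 2) - (Real.exp u - 1) / ‖x‖ ^ 2)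
        • outer x := by module
  rw [e]
  rcases eq_or_ne (‖x‖ ^ 2) 0 with h0 | h0
  · rw [outer_eq_zero_of_norm h0, smul_zero]; exact Matrix.PosSemidef.zero
  · refine (posSemidef_outer x).smul ?_
    have hpos : 0 < ‖x‖ ^ 2 := lt_of_le_of_ne (sq_nonneg _) h0.symm
    rw [abs_mul, abs_of_pos hθ, Real.mul_rpow hθ.le (abs_nonneg _)] at hu
    have : σ * θ + c * θ ^ α * (|‖x‖ ^ 2| ^ α / ‖x‖ ^ 2) - (Real.exp u - 1) / ‖x‖ ^ 2
        = (1 + σ * (θ * ‖x‖ ^ 2) + c * (θ ^ α * |‖x‖ ^ 2| ^ α) - Real.exp u) / ‖x‖ ^ 2 := by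
      rw [eq_div_iff h0, sub_mul, add_mul, div_mul_cancel₀ _ h0, mul_assoc (c * θ ^ α),
        div_mul_cancel₀ _ h0]
      ring
    rw [this]
    exact div_nonneg (sub_nonneg.2 hu) hpos.le

end RankOne

/-! ### Spectral norm against traces of exponentials. -/

section SpecNorm

variable {d : ℕ}

open scoped Matrix.Norms.L2Operator in
theorem specNorm_conj_diagonal {U : Matrix (Fin d) (Fin d) ℝ} (hU : Uᵀ * U = 1) (hU' : U * Uᵀ = 1)
    (a : Fin d → ℝ) : specNorm (U * diagonal a * Uᵀ) = ‖a‖ := by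
  have hmem : U ∈ unitary (Matrix (Fin d) (Fin d) ℝ) := by
    rw [Unitary.mem_iff, Matrix.star_eq_conjTranspose, Matrix.conjTranspose_eq_transpose_of_trivial]
    exact ⟨hU, hU'⟩
  have hmem' : Uᵀ ∈ unitary (Matrix (Fin d) (Fin d) ℝ) := by
    have := Unitary.star_mem hmem
    rwa [Matrix.star_eq_conjTranspose, Matrix.conjTranspose_eq_transpose_of_trivial] at this
  rw [specNorm, ← Matrix.cstar_norm_def, CStarRing.norm_mul_mem_unitary _ hmem',
    CStarRing.norm_mem_unitary_mul _ hmem, Matrix.l2_opNorm_diagonal]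

theorem specNorm_smul (c : ℝ) (A : Matrix (Fin d) (Fin d) ℝ) :
    specNorm (c • A) = |c| * specNorm A := by
  rw [specNorm, map_smul, norm_smul, Real.norm_eq_abs, specNorm]

theorem specNorm_nonneg (A : Matrix (Fin d) (Fin d) ℝ) : 0 ≤ specNorm A := norm_nonneg _

/-- A Hermitian matrix of spectral norm at least `s` has a large trace of `2 cosh`. -/
theorem le_trace_exp_add_trace_exp_neg {S : Matrix (Fin d) (Fin d) ℝ} (hS : S.IsHermitian) {s : ℝ}
    (hs : 0 < s) (h : s ≤ specNorm S) :
    Real.exp s - s - 1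
      ≤ trace (NormedSpace.exp S) + trace (NormedSpace.exp (-S)) - 2 * d := by
  obtain ⟨U, a, hU, hU', rfl⟩ := exists_orthogonal_diagonal hS
  rw [specNorm_conj_diagonal hU hU'] at h
  obtain ⟨k, hk⟩ : ∃ k, s ≤ |a k| := by
    by_contra! hcon
    exact absurd h (not_le.2 ((pi_norm_lt_iff hs).2 hcon))
  rw [neg_conj_diagonal, exp_conj_diagonal hU', exp_conj_diagonal hU', trace_conj_diagonal hU,
    trace_conj_diagonal hU, ← Finset.sum_add_distrib]
  have hd : (2 * d : ℝ) = ∑ _i : Fin d, 2 := by simp [mul_comm]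
  rw [hd, ← Finset.sum_sub_distrib]
  have hcosh : ∀ y : ℝ, Real.exp y + Real.exp (-y) = 2 * Real.cosh y := fun y => by
    rw [Real.cosh_eq]; ring
  have hk' : Real.cosh s ≤ Real.cosh (a k) :=
    Real.cosh_le_cosh.2 (by rwa [abs_of_pos hs])
  -- All summands `2 cosh (a i) - 2` are nonnegative, so only the extreme eigenvalue is kept.
  calc Real.exp s - s - 1 ≤ Real.exp s + Real.exp (-s) - 2 := by
        have := Real.add_one_le_exp (-s)
        linarith
    _ ≤ Real.exp (a k) + Real.exp (- a k) - 2 := by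
        rw [hcosh, hcosh]; linarith
    _ ≤ _ := Finset.single_le_sum (f := fun i => Real.exp (a i) + Real.exp (- a i) - 2)
        (fun i _ => by
          have := Real.one_le_cosh (a i)
          simp only [hcosh]; linarith) (Finset.mem_univ k)

/-- Nonnegativity for Markov's inequality: in `1 + a ≤ exp a` the linear terms of `S` and `-S`
cancel. -/
theorem trace_exp_add_trace_exp_neg_sub_nonneg {S : Matrix (Fin d) (Fin d) ℝ}
    (hS : S.IsHermitian) :
    0 ≤ trace (NormedSpace.exp S) + trace (NormedSpace.exp (-S)) - 2 * d := by
  have key : ∀ T : Matrix (Fin d) (Fin d) ℝ, T.IsHermitian →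
      trace T + d ≤ trace (NormedSpace.exp T) := by
    intro T hT
    obtain ⟨U, a, hU, hU', rfl⟩ := exists_orthogonal_diagonal hT
    have hd : (d : ℝ) = ∑ _i : Fin d, 1 := by simp
    rw [exp_conj_diagonal hU', trace_conj_diagonal hU, trace_conj_diagonal hU, hd, ← Finset.sum_add_distrib]
    exact Finset.sum_le_sum fun i _ => Real.add_one_le_exp _
  have h2 := key S hS
  have h3 := key (-S) hS.neg
  rw [Matrix.trace_neg] at h3
  linarith

/-- Subtracting `1` from each eigenvalue of the exponential makes small eigenvalues of `M`
contribute in proportion to their size; this is how the effective dimension enters. -/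
theorem trace_exp_smul_sub_le {M : Matrix (Fin d) (Fin d) ℝ} (hM : M.PosSemidef) (κ : ℝ) :
    trace (NormedSpace.exp (κ • M)) - d
      ≤ trace M / specNorm M * (Real.exp (κ * specNorm M) - 1) := by
  obtain ⟨U, a, hU, hU', hMe⟩ := exists_orthogonal_diagonal hM.1
  have ha : ∀ i, 0 ≤ a i := nonneg_of_posSemidef_conj_diagonal hU (hMe ▸ hM)
  have hd : (d : ℝ) = ∑ _i : Fin d, 1 := by simp
  rw [hMe, smul_conj_diagonal, exp_conj_diagonal hU', specNorm_conj_diagonal hU hU',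
    trace_conj_diagonal hU, trace_conj_diagonal hU, hd,
    ← Finset.sum_sub_distrib, Finset.sum_div, Finset.sum_mul]
  refine Finset.sum_le_sum fun i _ => exp_mul_sub_one_le (ha i) ?_
  exact (le_abs_self _).trans (norm_le_pi_norm a i)

end SpecNorm

/-! ### Exponential trace moments of independent sums. -/

section MasterBound

variable {d : ℕ}

theorem trace_exp_nonneg {S : Matrix (Fin d) (Fin d) ℝ} (hS : S.IsHermitian) :
    0 ≤ trace (NormedSpace.exp S) := by
  obtain ⟨U, a, hU, hU', rfl⟩ := exists_orthogonal_diagonal hS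
  rw [exp_conj_diagonal hU']
  exact (posSemidef_conj_diagonal U fun i => (Real.exp_pos (a i)).le).trace_nonneg

theorem posSemidef_exp_sub_one_sub {S : Matrix (Fin d) (Fin d) ℝ} (hS : S.IsHermitian) :
    (NormedSpace.exp S - (1 + S)).PosSemidef := by
  obtain ⟨U, a, hU, hU', rfl⟩ := exists_orthogonal_diagonal hS
  have e : (1 : Matrix (Fin d) (Fin d) ℝ) = U * diagonal (fun _ => 1) * Uᵀ := by
    rw [Matrix.diagonal_one, Matrix.mul_one, hU']
  rw [exp_conj_diagonal hU']
  conv in 1 + _ => rw [e]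
  rw [← Matrix.add_mul, ← Matrix.mul_add, Matrix.diagonal_add, ← Matrix.sub_mul, ← Matrix.mul_sub,
    Matrix.diagonal_sub]
  refine posSemidef_conj_diagonal U fun i => ?_
  have := Real.add_one_le_exp (a i)
  linarith

theorem continuous_trace_exp :
    Continuous fun S : Matrix (Fin d) (Fin d) ℝ => trace (NormedSpace.exp S) := by
  have h : Continuous (NormedSpace.exp : Matrix (Fin d) (Fin d) ℝ → Matrix (Fin d) (Fin d) ℝ) := by
    let _ : NormedRing (Matrix (Fin d) (Fin d) ℝ) := Matrix.linftyOpNormedRing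
    let _ : NormedAlgebra ℚ (Matrix (Fin d) (Fin d) ℝ) := Matrix.linftyOpNormedAlgebra
    let _ : NormedSpace ℝ (Matrix (Fin d) (Fin d) ℝ) := Matrix.linftyOpNormedSpace
    have : CompleteSpace (Matrix (Fin d) (Fin d) ℝ) := FiniteDimensional.complete ℝ _
    exact NormedSpace.exp_continuous
  exact h.matrix_trace

theorem measurable_trace_exp {E : Type*} [MeasurableSpace E] {S : E → Matrix (Fin d) (Fin d) ℝ}
    (hS : ∀ i j, Measurable fun x => S x i j) :
    Measurable fun x => trace (NormedSpace.exp (S x)) := by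
  have hc : Continuous fun M : Fin d → Fin d → ℝ => trace (NormedSpace.exp (Matrix.of M)) :=
    continuous_trace_exp
  exact hc.measurable.comp
    (measurable_pi_lambda _ fun i => measurable_pi_lambda _ fun j => hS i j)

theorem expMat_apply {E : Type*} [MeasurableSpace E] (μ : Measure E)
    (W : E → Matrix (Fin d) (Fin d) ℝ) (i j : Fin d) : expMat μ W i j = ∫ x, W x i j ∂μ := rfl

theorem integrable_trace_mul {E : Type*} [MeasurableSpace E] {μ : Measure E}
    {W : E → Matrix (Fin d) (Fin d) ℝ} (hW : ∀ i j, Integrable (fun x => W x i j) μ)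
    (G : Matrix (Fin d) (Fin d) ℝ) : Integrable (fun x => trace (G * W x)) μ := by
  simp only [trace, Matrix.diag, Matrix.mul_apply]
  exact integrable_finsetSum _ fun i _ => integrable_finsetSum _ fun j _ =>
    (hW j i).const_mul _

theorem trace_mul_expMat {E : Type*} [MeasurableSpace E] {μ : Measure E}
    {W : E → Matrix (Fin d) (Fin d) ℝ} (hW : ∀ i j, Integrable (fun x => W x i j) μ)
    (G : Matrix (Fin d) (Fin d) ℝ) : trace (G * expMat μ W) = ∫ x, trace (G * W x) ∂μ := by
  simp only [trace, Matrix.diag, Matrix.mul_apply, expMat_apply]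
  have hint : ∀ i j, Integrable (fun x => G i j * W x j i) μ := fun i j => (hW j i).const_mul _
  rw [integral_finsetSum _ fun i _ => integrable_finsetSum _ fun j _ => hint i j]
  refine Finset.sum_congr rfl fun i _ => ?_
  rw [integral_finsetSum _ fun j _ => hint i j]
  exact Finset.sum_congr rfl fun j _ => (integral_const_mul _ _).symm

theorem isHermitian_expMat {E : Type*} [MeasurableSpace E] {μ : Measure E}
    {W : E → Matrix (Fin d) (Fin d) ℝ} (hW : ∀ x, (W x).IsHermitian) :
    (expMat μ W).IsHermitian := by
  ext i j
  simp only [Matrix.conjTranspose_apply, expMat_apply, star_trivial]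
  refine integral_congr_ae (Filter.Eventually.of_forall fun x => ?_)
  simpa using (hW x).apply i j

theorem posSemidef_expMat {E : Type*} [MeasurableSpace E] {μ : Measure E}
    {W : E → Matrix (Fin d) (Fin d) ℝ} (hint : ∀ i j, Integrable (fun x => W x i j) μ)
    (hW : ∀ x, (W x).PosSemidef) : (expMat μ W).PosSemidef := by
  refine Matrix.PosSemidef.of_dotProduct_mulVec_nonneg (isHermitian_expMat fun x => (hW x).1)
    fun y => ?_
  have e : ∀ M : Matrix (Fin d) (Fin d) ℝ,
      star y ⬝ᵥ M.mulVec y = trace (Matrix.vecMulVec y y * M) := by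
    intro M
    rw [Matrix.trace_mul_comm, Matrix.mul_vecMulVec, Matrix.trace_vecMulVec, dotProduct_comm]
    simp
  rw [e, trace_mul_expMat hint]
  refine integral_nonneg fun x => ?_
  rw [← e]
  exact (hW x).dotProduct_mulVec_nonneg y

variable {E : Type*} [MeasurableSpace E] {μ : Measure E} [IsProbabilityMeasure μ]
  {Y W : E → Matrix (Fin d) (Fin d) ℝ}

/-- Averaging one random summand in the exponent. -/
theorem lintegral_trace_exp_add_le (hY : ∀ x, (Y x).IsHermitian) (hWh : ∀ x, (W x).IsHermitian)
    (hYW : ∀ x, (1 + W x - NormedSpace.exp (Y x)).PosSemidef)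
    (hW : ∀ i j, Integrable (fun x => W x i j) μ) {H : Matrix (Fin d) (Fin d) ℝ}
    (hH : H.IsHermitian) :
    ∫⁻ x, ENNReal.ofReal (trace (NormedSpace.exp (H + Y x))) ∂μ
      ≤ ENNReal.ofReal (trace (NormedSpace.exp (H + expMat μ W))) := by
  have hK : (expMat μ W).IsHermitian := isHermitian_expMat hWh
  -- The support is taken at `exp K` with `K = E W`, not at `1 + K`: no logarithm of `1 + K` is
  -- needed, and `1 + K ≤ exp K` closes the argument once the linear functional has been averaged.
  obtain ⟨G, hG, hle, heq⟩ := exists_lieb_support hH hK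
  have hpt : ∀ x, trace (NormedSpace.exp (H + Y x)) ≤ trace G + trace (G * W x) := by
    intro x
    refine (hle _ (hY x)).trans ?_
    have := trace_mul_nonneg hG (hYW x)
    rw [Matrix.mul_sub, Matrix.mul_add, Matrix.trace_sub, Matrix.trace_add, Matrix.mul_one] at this
    linarith
  have hint : Integrable (fun x => trace G + trace (G * W x)) μ :=
    (integrable_const _).add (integrable_trace_mul hW G)
  have hnn : ∀ x, 0 ≤ trace G + trace (G * W x) := fun x =>
    (trace_exp_nonneg (hH.add (hY x))).trans (hpt x)
  calc _ ≤ ∫⁻ x, ENNReal.ofReal (trace G + trace (G * W x)) ∂μ :=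
        lintegral_mono fun x => ENNReal.ofReal_le_ofReal (hpt x)
    _ = ENNReal.ofReal (∫ x, (trace G + trace (G * W x)) ∂μ) :=
        (ofReal_integral_eq_lintegral_ofReal hint (Filter.Eventually.of_forall hnn)).symm
    _ ≤ _ := ENNReal.ofReal_le_ofReal ?_
  rw [integral_add (integrable_const _) (integrable_trace_mul hW G), ← trace_mul_expMat hW,
    integral_const, ← heq]
  have := trace_mul_nonneg hG (posSemidef_exp_sub_one_sub hK)
  rw [Matrix.mul_sub, Matrix.mul_add, Matrix.trace_sub, Matrix.trace_add, Matrix.mul_one] at this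
  simp only [probReal_univ, one_smul]
  linarith

theorem isHermitian_sum {ι : Type*} (s : Finset ι) {A : ι → Matrix (Fin d) (Fin d) ℝ}
    (hA : ∀ i, (A i).IsHermitian) : (∑ i ∈ s, A i).IsHermitian := by
  rw [Matrix.IsHermitian, Matrix.conjTranspose_sum]
  exact Finset.sum_congr rfl fun i _ => hA i

/-- The master bound for sums of independent random matrices. -/
theorem lintegral_trace_exp_sum_le (hY : ∀ x, (Y x).IsHermitian) (hWh : ∀ x, (W x).IsHermitian)
    (hYm : ∀ i j, Measurable fun x => Y x i j)
    (hYW : ∀ x, (1 + W x - NormedSpace.exp (Y x)).PosSemidef)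
    (hW : ∀ i j, Integrable (fun x => W x i j) μ) (n : ℕ) {H : Matrix (Fin d) (Fin d) ℝ}
    (hH : H.IsHermitian) :
    ∫⁻ x, ENNReal.ofReal (trace (NormedSpace.exp (H + ∑ i, Y (x i))))
        ∂(Measure.pi fun _ : Fin n => μ)
      ≤ ENNReal.ofReal (trace (NormedSpace.exp (H + (n : ℝ) • expMat μ W))) := by
  induction n generalizing H with
  | zero => simp
  | succ n ih =>
    have hmeas : Measurable fun z : E × (Fin n → E) =>
        ENNReal.ofReal (trace (NormedSpace.exp (H + (Y z.1 + ∑ i, Y (z.2 i))))) := by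
      refine (measurable_trace_exp fun i j => ?_).ennreal_ofReal
      simp only [Matrix.add_apply, Matrix.sum_apply]
      exact measurable_const.add (((hYm i j).comp measurable_fst).add
        (Finset.measurable_sum _ fun k _ =>
          (hYm i j).comp ((measurable_pi_apply k).comp measurable_snd)))
    -- Tonelli splits off coordinate `0`; with `∫⁻` no integrability is required beforehand. The
    -- mean of that summand's bound is absorbed into `H`, which is why the induction generalizes
    -- `H`.
    have hmp := measurePreserving_piFinSuccAbove (fun _ : Fin (n + 1) => μ) 0
    have hcomp := hmp.lintegral_comp hmeas
    have e : ∀ x : Fin (n + 1) → E,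
        ((MeasurableEquiv.piFinSuccAbove (fun _ : Fin (n + 1) => E) 0) x).1 = x 0 ∧
        ∀ i, ((MeasurableEquiv.piFinSuccAbove (fun _ : Fin (n + 1) => E) 0) x).2 i = x i.succ :=
      fun x => ⟨rfl, fun i => rfl⟩
    simp only [fun x => (e x).1, fun x => (e x).2] at hcomp
    simp only [Fin.sum_univ_succ]
    rw [hcomp, lintegral_prod_symm _ hmeas.aemeasurable]
    have hK : (expMat μ W).IsHermitian := isHermitian_expMat hWh
    calc _ ≤ ∫⁻ y, ENNReal.ofReal (trace (NormedSpace.exp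
            ((H + expMat μ W) + ∑ i, Y (y i)))) ∂(Measure.pi fun _ : Fin n => μ) := by
          refine lintegral_mono fun y => ?_
          have := lintegral_trace_exp_add_le hY hWh hYW hW
            (hH.add (isHermitian_sum Finset.univ fun i => hY (y i)))
          refine (le_of_eq ?_).trans (this.trans (le_of_eq ?_))
          · refine lintegral_congr fun x => ?_
            rw [add_assoc, add_comm (∑ i, Y (y i)) (Y x)]
          · rw [add_right_comm]
      _ ≤ _ := ih (hH.add hK)
      _ = _ := by
          congr 3
          push_cast
          rw [add_smul, one_smul]
          abel_nf

end MasterBound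

/-! ### Integrability from the moment assumption. -/

section Moments

variable {d : ℕ} {Ω : Type*} [MeasurableSpace Ω] {P : Measure Ω}

theorem trace_absPow {α : ℝ} (hα : 1 < α) (x : EuclideanSpace ℝ (Fin d)) :
    trace (absPow α x) = (‖x‖ ^ 2) ^ α := by
  rw [absPow_eq hα, Matrix.trace_smul, trace_outer, smul_eq_mul]
  rcases eq_or_ne (‖x‖ ^ 2) 0 with h | h
  · simp [h, Real.zero_rpow (by linarith : α ≠ 0)]
  · rw [div_mul_cancel₀ _ h, abs_of_nonneg (sq_nonneg _)]

theorem posSemidef_absPow {α : ℝ} (hα : 1 < α) (x : EuclideanSpace ℝ (Fin d)) :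
    (absPow α x).PosSemidef := by
  rw [absPow_eq hα]
  exact (posSemidef_outer x).smul (by positivity)

theorem continuous_outer_apply (i j : Fin d) :
    Continuous fun x : EuclideanSpace ℝ (Fin d) => outer x i j := by
  simp only [outer, Matrix.of_apply]
  fun_prop

theorem FiniteMoment.integrable_norm_rpow {α : ℝ} (hα : 1 < α)
    {X : Ω → EuclideanSpace ℝ (Fin d)} (h : FiniteMoment P α X) :
    Integrable (fun ω => (‖X ω‖ ^ 2) ^ α) P := by
  have : Integrable (fun ω => trace (absPow α (X ω))) P :=
    integrable_finsetSum _ fun i _ => h i i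
  simpa only [trace_absPow hα] using this

/-- Domination: `|x i * x j| ≤ ‖x‖² ≤ 1 + (‖x‖²)^α`, and the last power is the trace of `|xxᵀ|^α`.
-/
theorem FiniteMoment.integrable_outer [IsFiniteMeasure P] {α : ℝ} (hα : 1 < α)
    {X : Ω → EuclideanSpace ℝ (Fin d)} (hX : AEMeasurable X P) (h : FiniteMoment P α X)
    (i j : Fin d) : Integrable (fun ω => outer (X ω) i j) P := by
  have hint : Integrable (fun ω => 1 + (‖X ω‖ ^ 2) ^ α) P :=
    (integrable_const _).add (h.integrable_norm_rpow hα)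
  refine hint.mono' ((continuous_outer_apply i j).measurable.comp_aemeasurable hX).aestronglyMeasurable
    (Filter.Eventually.of_forall fun ω => ?_)
  have h1 : ‖outer (X ω) i j‖ ≤ ‖X ω‖ ^ 2 := by
    simp only [outer, Matrix.of_apply, norm_mul, sq]
    exact mul_le_mul (PiLp.norm_apply_le _ i) (PiLp.norm_apply_le _ j) (norm_nonneg _)
      (norm_nonneg _)
  refine h1.trans ?_
  rcases le_total (‖X ω‖ ^ 2) 1 with hle | hle
  · exact hle.trans (by have := Real.rpow_nonneg (sq_nonneg ‖X ω‖) α; linarith)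
  · have := Real.self_le_rpow_of_one_le hle hα.le
    linarith

end Moments

/-! ### The deviation of the shrinkage estimator. -/

section Estimator

variable {d : ℕ} {Ω : Type*} [MeasurableSpace Ω] {P : Measure Ω}

theorem measurable_absPow_apply {α : ℝ} (hα : 1 < α) (i j : Fin d) :
    Measurable fun x : EuclideanSpace ℝ (Fin d) => absPow α x i j := by
  simp only [absPow_eq hα, Matrix.smul_apply, smul_eq_mul]
  have h1 : Measurable fun x : EuclideanSpace ℝ (Fin d) => ‖x‖ ^ 2 := by fun_prop
  exact (((continuous_abs.measurable.comp h1).pow_const α).div h1).mul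
    (continuous_outer_apply i j).measurable

theorem expMat_map {X : Ω → EuclideanSpace ℝ (Fin d)} (hX : AEMeasurable X P)
    {W : EuclideanSpace ℝ (Fin d) → Matrix (Fin d) (Fin d) ℝ}
    (hW : ∀ i j, Measurable fun x => W x i j) :
    expMat (P.map X) W = expMat P fun ω => W (X ω) := by
  ext i j
  exact integral_map hX (hW i j).aestronglyMeasurable

theorem integrable_and_integral_le {E : Type*} [MeasurableSpace E] {μ : Measure E} {f : E → ℝ}
    (hf : Measurable f) (hf0 : ∀ x, 0 ≤ f x) {b : ℝ} (hb : 0 ≤ b)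
    (h : ∫⁻ x, ENNReal.ofReal (f x) ∂μ ≤ ENNReal.ofReal b) :
    Integrable f μ ∧ ∫ x, f x ∂μ ≤ b := by
  refine ⟨⟨hf.aestronglyMeasurable, ?_⟩, ?_⟩
  · rw [hasFiniteIntegral_iff_ofReal (Filter.Eventually.of_forall hf0)]
    exact h.trans_lt ENNReal.ofReal_lt_top
  · rw [integral_eq_lintegral_of_nonneg_ae (Filter.Eventually.of_forall hf0)
      hf.aestronglyMeasurable]
    exact (ENNReal.toReal_mono ENNReal.ofReal_ne_top h).trans_eq (ENNReal.toReal_ofReal hb)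

/-- The exponential trace moment of a sum of truncated rank-one matrices. -/
theorem lintegral_trace_exp_rankOne_le [IsProbabilityMeasure P] {α θ σ : ℝ} (hα : 1 < α)
    (hθ : 0 < θ) {X : Ω → EuclideanSpace ℝ (Fin d)} (hX : AEMeasurable X P)
    (hmoment : FiniteMoment P α X) {g : ℝ → ℝ} (hgm : Measurable g)
    (hg : ∀ x, 0 ≤ x → Real.exp (g x) ≤ 1 + σ * x + cAlpha α * |x| ^ α) (n : ℕ) :
    ∫⁻ x, ENNReal.ofReal (trace (NormedSpace.exp
        (-((n * (σ * θ)) • expMat P fun ω => outer (X ω))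
          + ∑ i, (g (θ * ‖x i‖ ^ 2) / ‖x i‖ ^ 2) • outer (x i))))
        ∂(Measure.pi fun _ : Fin n => P.map X)
      ≤ ENNReal.ofReal (trace (NormedSpace.exp
          ((cAlpha α * n * θ ^ α) • expMat P fun ω => absPow α (X ω)))) := by
  have : IsProbabilityMeasure (P.map X) := Measure.isProbabilityMeasure_map hX
  have hout := hmoment.integrable_outer hα hX
  set W : EuclideanSpace ℝ (Fin d) → Matrix (Fin d) (Fin d) ℝ := fun x =>
    (σ * θ) • outer x + (cAlpha α * θ ^ α) • absPow α x with hWdef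
  have hWm : ∀ i j, Measurable fun x => W x i j := fun i j =>
    ((continuous_outer_apply i j).measurable.const_mul _).add
      ((measurable_absPow_apply hα i j).const_mul _)
  have hWint : ∀ i j, Integrable (fun x => W x i j) (P.map X) := fun i j =>
    (integrable_map_measure (hWm i j).aestronglyMeasurable hX).2
      (((hout i j).const_mul _).add ((hmoment i j).const_mul _))
  have hK : expMat (P.map X) W = (σ * θ) • (expMat P fun ω => outer (X ω))
      + (cAlpha α * θ ^ α) • expMat P fun ω => absPow α (X ω) := by
    rw [expMat_map hX hWm]
    ext i j
    simp only [hWdef, expMat_apply, Matrix.add_apply, Matrix.smul_apply, smul_eq_mul]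
    rw [integral_add ((hout i j).const_mul _) ((hmoment i j).const_mul _), integral_const_mul,
      integral_const_mul]
  have hsm : ∀ (u : ℝ) (x : EuclideanSpace ℝ (Fin d)), (u • outer x).IsHermitian := fun u x =>
    isHermitian_smul u (isHermitian_outer x)
  have hH : (-((n * (σ * θ)) • expMat P fun ω => outer (X ω))).IsHermitian := by
    have := isHermitian_expMat (μ := P) (W := fun ω => outer (X ω)) fun ω =>
      isHermitian_outer (X ω)
    exact (isHermitian_smul _ this).neg
  have hnorm : Measurable fun x : EuclideanSpace ℝ (Fin d) => ‖x‖ ^ 2 := by fun_prop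
  have key := lintegral_trace_exp_sum_le (μ := P.map X) (W := W)
    (Y := fun x => (g (θ * ‖x‖ ^ 2) / ‖x‖ ^ 2) • outer x) (fun x => hsm _ x)
    (fun x => (hsm _ x).add ?_) (fun i j => ?_)
    (fun x => posSemidef_one_add_sub_exp hα hθ x (hg _ (by positivity))) hWint n hH
  · refine key.trans_eq ?_
    -- The centring term cancels the linear part of `n • expMat W`; only the `α`-moment survives.
    rw [hK]
    congr 3
    module
  · rw [absPow_eq hα, smul_smul]
    exact hsm _ x
  · exact ((hgm.comp (hnorm.const_mul θ)).div hnorm).mul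
      (continuous_outer_apply i j).measurable

/-- The normalized deviation of the estimator. -/
noncomputable def deviation {n : ℕ} (ψ : ℝ → ℝ) (θ : ℝ) (S : Matrix (Fin d) (Fin d) ℝ)
    (x : Fin n → EuclideanSpace ℝ (Fin d)) : Matrix (Fin d) (Fin d) ℝ :=
  -((n * θ) • S) + ∑ i, matFun ψ (θ • outer (x i))

theorem estimator_sub_eq {n : ℕ} (hn : 0 < n) (ψ : ℝ → ℝ) {θ : ℝ} (hθ : 0 < θ)
    (S : Matrix (Fin d) (Fin d) ℝ) (x : Fin n → EuclideanSpace ℝ (Fin d)) :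
    estimator ψ θ x - S = (1 / (n * θ)) • deviation ψ θ S x := by
  have : (n * θ : ℝ) ≠ 0 := by positivity
  rw [estimator, deviation, smul_add, smul_neg, smul_smul, one_div_mul_cancel this, one_smul]
  abel

theorem deviation_eq {n : ℕ} {ψ : ℝ → ℝ} (hψ : ψ 0 = 0) {θ : ℝ} (hθ : 0 < θ)
    (S : Matrix (Fin d) (Fin d) ℝ) (x : Fin n → EuclideanSpace ℝ (Fin d)) :
    deviation ψ θ S x
      = -((n * (1 * θ)) • S) + ∑ i, (ψ (θ * ‖x i‖ ^ 2) / ‖x i‖ ^ 2) • outer (x i) := by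
  rw [deviation, one_mul]
  simp only [matFun_smul_outer hψ hθ.ne']

/-- The shape of `deviation_eq` with sign `σ = -1` and `g = -ψ`, so that
`lintegral_trace_exp_rankOne_le` serves both tails. -/
theorem neg_deviation_eq {n : ℕ} {ψ : ℝ → ℝ} (hψ : ψ 0 = 0) {θ : ℝ} (hθ : 0 < θ)
    (S : Matrix (Fin d) (Fin d) ℝ) (x : Fin n → EuclideanSpace ℝ (Fin d)) :
    -deviation ψ θ S x
      = -((n * (-1 * θ)) • S) + ∑ i, (-ψ (θ * ‖x i‖ ^ 2) / ‖x i‖ ^ 2) • outer (x i) := by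
  rw [deviation_eq hψ hθ, neg_add, ← Finset.sum_neg_distrib]
  congr 1
  · module
  · exact Finset.sum_congr rfl fun i _ => by rw [neg_div, neg_smul]

theorem isHermitian_deviation {n : ℕ} {ψ : ℝ → ℝ} (hψ : ψ 0 = 0) {θ : ℝ} (hθ : 0 < θ)
    {S : Matrix (Fin d) (Fin d) ℝ} (hS : S.IsHermitian)
    (x : Fin n → EuclideanSpace ℝ (Fin d)) : (deviation ψ θ S x).IsHermitian := by
  rw [deviation_eq hψ hθ]
  refine (isHermitian_smul _ hS).neg.add (isHermitian_sum _ fun i => ?_)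
  exact isHermitian_smul _ (isHermitian_outer (x i))

theorem measurable_deviation_apply {n : ℕ} {ψ : ℝ → ℝ} (hψ : ψ 0 = 0) (hm : Measurable ψ) {θ : ℝ}
    (hθ : 0 < θ) (S : Matrix (Fin d) (Fin d) ℝ) (i j : Fin d) :
    Measurable fun x : Fin n → EuclideanSpace ℝ (Fin d) => deviation ψ θ S x i j := by
  have hnorm : Measurable fun x : EuclideanSpace ℝ (Fin d) => ‖x‖ ^ 2 := by fun_prop
  simp only [deviation_eq hψ hθ, Matrix.add_apply, Matrix.sum_apply]
  refine measurable_const.add (Finset.measurable_sum _ fun k _ => ?_)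
  have h : Measurable fun x : EuclideanSpace ℝ (Fin d) =>
      ((ψ (θ * ‖x‖ ^ 2) / ‖x‖ ^ 2) • outer x) i j :=
    ((hm.comp (hnorm.const_mul θ)).div hnorm).mul (continuous_outer_apply i j).measurable
  exact h.comp (measurable_pi_apply k)

/-- The trace moment bound for the deviation, from both exponential moments. -/
theorem integrable_and_integral_trace_deviation_le [IsProbabilityMeasure P] {n : ℕ} {α θ : ℝ}
    (hα₁ : 1 < α) (hα₂ : α ≤ 2) (hθ : 0 < θ) {X : Ω → EuclideanSpace ℝ (Fin d)}
    (hX : AEMeasurable X P) (hmoment : FiniteMoment P α X) {ψ : ℝ → ℝ} (hψ : IsPsi α ψ) :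
    let Z : (Fin n → EuclideanSpace ℝ (Fin d)) → ℝ := fun x =>
      trace (NormedSpace.exp (deviation ψ θ (expMat P fun ω => outer (X ω)) x))
        + trace (NormedSpace.exp (-deviation ψ θ (expMat P fun ω => outer (X ω)) x)) - 2 * d
    Integrable Z (Measure.pi fun _ : Fin n => P.map X) ∧
      ∫ x, Z x ∂(Measure.pi fun _ : Fin n => P.map X)
        ≤ 2 * (effDim P α X * (Real.exp (cAlpha α * n * θ ^ α * vPow P α X) - 1)) := by
  intro Z
  have : IsProbabilityMeasure (P.map X) := Measure.isProbabilityMeasure_map hX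
  have h0 := hψ.map_zero hα₁
  have hm := hψ.mono.measurable
  set S := expMat P fun ω => outer (X ω)
  set M := expMat P fun ω => absPow α (X ω)
  have hS : S.IsHermitian := isHermitian_expMat fun ω => isHermitian_outer (X ω)
  have hM : M.PosSemidef := posSemidef_expMat hmoment fun ω => posSemidef_absPow hα₁ (X ω)
  have hD := fun x : Fin n → EuclideanSpace ℝ (Fin d) => isHermitian_deviation h0 hθ hS x
  have hDm := fun i j => measurable_deviation_apply (n := n) h0 hm hθ S i j
  have hb : 0 ≤ trace (NormedSpace.exp ((cAlpha α * n * θ ^ α) • M)) :=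
    trace_exp_nonneg (isHermitian_smul _ hM.1)
  obtain ⟨hi1, hle1⟩ := integrable_and_integral_le (measurable_trace_exp hDm)
    (fun x => trace_exp_nonneg (hD x)) hb (by
      simp only [deviation_eq h0 hθ]
      exact lintegral_trace_exp_rankOne_le hα₁ hθ hX hmoment hm
        (fun x hx => by rw [one_mul]; exact hψ.exp_le hα₁ hx) n)
  obtain ⟨hi2, hle2⟩ := integrable_and_integral_le
    (measurable_trace_exp (S := fun x => -deviation ψ θ S x) fun i j => (hDm i j).neg)
    (fun x => trace_exp_nonneg (hD x).neg) hb (by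
      simp only [neg_deviation_eq h0 hθ]
      exact lintegral_trace_exp_rankOne_le hα₁ hθ hX hmoment (g := fun y => - ψ y) hm.neg
        (fun x hx => by
          rw [neg_one_mul, ← sub_eq_add_neg]; exact hψ.exp_neg_le hα₁ hα₂ hx) n)
  refine ⟨(hi1.add hi2).sub (integrable_const _), ?_⟩
  have hsplit := integral_sub (hi1.add hi2) (integrable_const (2 * d : ℝ))
  simp only [Pi.add_apply] at hsplit
  rw [integral_add hi1 hi2, integral_const, probReal_univ, one_smul] at hsplit
  have hfin := trace_exp_smul_sub_le hM (cAlpha α * n * θ ^ α)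
  have : ∫ x, Z x ∂(Measure.pi fun _ : Fin n => P.map X) = _ := hsplit
  rw [this, effDim, vPow]
  linarith

theorem effDim_nonneg {α : ℝ} (hα : 1 < α) {X : Ω → EuclideanSpace ℝ (Fin d)}
    (hmoment : FiniteMoment P α X) : 0 ≤ effDim P α X :=
  div_nonneg (posSemidef_expMat hmoment fun ω => posSemidef_absPow hα (X ω)).trace_nonneg
    (specNorm_nonneg _)

end Estimator

end ShrinkageCov

theorem mainTheorem4 {Ω : Type*} [MeasurableSpace Ω] (P : Measure Ω) [IsProbabilityMeasure P]
    (d n : ℕ) (hn : 0 < n) (α : ℝ) (hα₁ : 1 < α) (hα₂ : α ≤ 2)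
    (X : Ω → EuclideanSpace ℝ (Fin d))
    (hmean : ∫ ω, X ω ∂P = 0)
    (hmoment : ShrinkageCov.FiniteMoment P α X)
    (Xs : Fin n → Ω → EuclideanSpace ℝ (Fin d))
    (hindep : iIndepFun Xs P)
    (hident : ∀ i, IdentDistrib (Xs i) X P P)
    (ψ : ℝ → ℝ) (hψ : ShrinkageCov.IsPsi α ψ)
    (θ t : ℝ) (hθ : 0 < θ) (ht : 0 < t) :
    P.real {ω | t ≤ ShrinkageCov.specNorm
        (ShrinkageCov.estimator ψ θ (fun i => Xs i ω)
          - ShrinkageCov.expMat P (fun ω' => ShrinkageCov.outer (X ω')))}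
      ≤ 2 * ShrinkageCov.effDim P α X * Real.exp (-(θ * n * t))
        * (Real.exp (ShrinkageCov.cAlpha α * n * θ ^ α * ShrinkageCov.vPow P α X)
            + ShrinkageCov.cAlpha α * n * θ ^ α * ShrinkageCov.vPow P α X)
        * (1 + 2 / (θ * n * t) + 2 / (θ * n * t) ^ 2) := by
  have hX : AEMeasurable X P := (hident ⟨0, hn⟩).aemeasurable_snd
  have hXs : ∀ i, AEMeasurable (Xs i) P := fun i => (hident i).aemeasurable_fst
  have hprob : IsProbabilityMeasure (P.map X) := Measure.isProbabilityMeasure_map hX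
  -- Independence and equal laws transfer the problem to the product measure, where the trace
  -- moments were bounded.
  have hmap : P.map (fun ω i => Xs i ω) = Measure.pi fun _ : Fin n => P.map X := by
    rw [(iIndepFun_iff_map_fun_eq_pi_map hXs).1 hindep]
    congr 1
    funext i
    exact (hident i).map_eq
  have hn' : (0 : ℝ) < n := Nat.cast_pos.2 hn
  obtain ⟨hint, hle⟩ := ShrinkageCov.integrable_and_integral_trace_deviation_le (n := n)
    hα₁ hα₂ hθ hX hmoment hψ
  have hS := ShrinkageCov.isHermitian_expMat (μ := P) (W := fun ω => ShrinkageCov.outer (X ω))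
    fun ω => ShrinkageCov.isHermitian_outer (X ω)
  have hD := fun x : Fin n → EuclideanSpace ℝ (Fin d) =>
    ShrinkageCov.isHermitian_deviation (hψ.map_zero hα₁) hθ hS x
  set S := ShrinkageCov.expMat P fun ω => ShrinkageCov.outer (X ω)
  set ν := Measure.pi fun _ : Fin n => P.map X
  set Z : (Fin n → EuclideanSpace ℝ (Fin d)) → ℝ := fun x =>
    trace (NormedSpace.exp (ShrinkageCov.deviation ψ θ S x))
      + trace (NormedSpace.exp (-ShrinkageCov.deviation ψ θ S x)) - 2 * d with hZ
  set s := θ * n * t with hs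
  have hs0 : 0 < s := by positivity
  set φ := Real.exp s - s - 1
  have hφ : 0 < φ := by
    have := Real.add_one_lt_exp hs0.ne'
    simp only [φ]; linarith
  have hsub : {ω | t ≤ ShrinkageCov.specNorm (ShrinkageCov.estimator ψ θ (fun i => Xs i ω) - S)}
      ⊆ (fun ω i => Xs i ω) ⁻¹' {x | φ ≤ Z x} := by
    intro ω hω
    rw [Set.mem_ofPred_eq, ShrinkageCov.estimator_sub_eq hn ψ hθ, ShrinkageCov.specNorm_smul,
      abs_of_pos (by positivity), one_div, ← div_eq_inv_mul, le_div_iff₀ (by positivity)] at hω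
    exact ShrinkageCov.le_trace_exp_add_trace_exp_neg (hD _) hs0
      (by rw [hs]; linarith)
  have hZm : Measurable Z := by
    have hDm := fun i j => ShrinkageCov.measurable_deviation_apply (n := n) (hψ.map_zero hα₁)
      hψ.mono.measurable hθ S i j
    exact ((ShrinkageCov.measurable_trace_exp hDm).add (ShrinkageCov.measurable_trace_exp
      (S := fun x => -ShrinkageCov.deviation ψ θ S x) fun i j => (hDm i j).neg)).sub_const _
  have h1 : P.real {ω | t ≤ ShrinkageCov.specNorm
      (ShrinkageCov.estimator ψ θ (fun i => Xs i ω) - S)} ≤ ν.real {x | φ ≤ Z x} := by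
    refine (measureReal_mono hsub).trans_eq ?_
    rw [← hmap, Measure.real, Measure.real, Measure.map_apply_of_aemeasurable
      (aemeasurable_pi_lambda _ hXs) (measurableSet_le measurable_const hZm)]
  -- Markov's inequality.
  have h2 : φ * ν.real {x | φ ≤ Z x} ≤ ∫ x, Z x ∂ν :=
    mul_meas_ge_le_integral_of_nonneg (Filter.Eventually.of_forall fun x =>
      ShrinkageCov.trace_exp_add_trace_exp_neg_sub_nonneg (hD x)) hint φ
  set q := ν.real {x | φ ≤ Z x}
  have hq : 0 ≤ q := measureReal_nonneg
  set B := Real.exp (-s) * (1 + 2 / s + 2 / s ^ 2) with hB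
  have hB0 : 0 ≤ B := by positivity
  have h3 : 1 ≤ φ * B := ShrinkageCov.one_le_exp_sub_mul hs0
  have hdim := ShrinkageCov.effDim_nonneg hα₁ hmoment
  set D := ShrinkageCov.effDim P α X
  have hκ : 0 ≤ ShrinkageCov.cAlpha α * n * θ ^ α * ShrinkageCov.vPow P α X :=
    mul_nonneg (mul_nonneg (mul_nonneg (ShrinkageCov.cAlpha_pos hα₁).le hn'.le)
      (Real.rpow_nonneg hθ.le _)) (ShrinkageCov.specNorm_nonneg _)
  set κ := ShrinkageCov.cAlpha α * n * θ ^ α * ShrinkageCov.vPow P α X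
  calc _ ≤ q := h1
    _ ≤ (φ * B) * q := le_mul_of_one_le_left hq h3
    _ = (φ * q) * B := by ring
    _ ≤ (2 * (D * (Real.exp κ - 1))) * B := mul_le_mul_of_nonneg_right (h2.trans hle) hB0
    -- The argument gives the sharper factor `exp κ - 1`; it is relaxed here using `κ ≥ 0`.
    _ ≤ (2 * (D * (Real.exp κ + κ))) * B := by gcongr; linarith
    _ = _ := by rw [hB]; ring
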